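/- **Setting (surface).** Let $T>0$ and let $\Gamma(t)=\Phi_t(\Gamma_0)\subset\mathbb R^3$, $t\in[0,T]$, be a closed compact evolving surface of class $C^k$, $k\ge 3$, where $\Gamma(t)$ is the boundary of a bounded open set, with outward unit normal $n_\Gamma$, and $\Phi_t$ is a $C^k$ diffeomorphism from $\Gamma_0$ onto $\Gamma(t)$ with $\Phi_0=\mathrm{id}$, $\frac{d}{dt}\Phi_t(z)=V_\Gamma^N(\Phi_t(z),t)$. The velocity $V_\Gamma^N=V_\Gamma n_\Gamma$ is purely normal and of class $C^1([0,T];C^k)$ (pulled back to $\Gamma_0$ by $\Phi_t$). **Setting (mesh).** Fix $k_g\ge1$, $k_u\ge2$, $k_{pr}=k_u-1$, $k_\lambda\ge1$. Let $\mathcal T_h(0)$ be obtained from a flat triangulation with vertices on $\Gamma_0$ by $k_g$-th order Lagrange interpolation of the closest point projection onto $\Gamma_0$, and let $\mathcal T_h(t)$, $\Gamma_h(t)=\bigcup_{\tau\in\mathcal T_h(t)}\tau$, be the triangulation obtained by moving the Lagrange nodes along $\Gamma(t)$ with $\Phi_t$. Assume that for every $t\in[0,T]$ it is conforming, that the closest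 point projection onto $\Gamma(t)$ is well defined on $\Gamma_h(t)$ and is a bijection $\Gamma_h(t)\to\Gamma(t)$, and that it is uniformly quasi-uniform with parameter $\rho>0$: with $h=\sup_{t,\tau}\operatorname{diam}\tau(t)$, for all $t\in[0,T]$ the flat triangle spanned by the vertices of each element is non-degenerate and contains a two-dimensional disc of radius $\rho h$. Let $n_h$ be the elementwise outward unit normal, $P_h=I-n_h\otimes n_h$, $\nabla^{cov}_{\Gamma_h}w=P_h\nabla_{\Gamma_h}w$, $H_h=\nabla^{cov}_{\Gamma_h}n_h$, $E_h(w)=\frac12(\nabla^{cov}_{\Gamma_h}w+(\nabla^{cov}_{\Gamma_h}w)^{T})$, and let $V_h^N$ be the material velocity of $\Gamma_h(t)$, i.e. the Lagrange interpolant of $V_\Gamma^N$ at the moving nodes. Let $S_h^k(t)$ be the continuous Lagrange finite element space of degree $k$ on $\Gamma_h(t)$, and $$\mathbf V_h=(S_h^{k_u})^3,\quad Q_h=S_h^{k_{pr}}\cap L^2_0(\Gamma_h(t)),\quad \Lambda_h=S_h^{k_\lambda}.$$ For a finite element function $z$ at one time, $\underline z(\cdot,t)$ denotes the finite element function on $\Gamma_h(t)$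 with the same nodal values. Put (all integrals over $\Gamma_h(t)$) $$m_h(w,v)=\int w\cdot v,\quad g_h(w,v)=\int \operatorname{div}_{\Gamma_h}(V_h^N)\,w\cdot v,\quad a_{S,h}(w,v)=\int E_h(w):E_h(v),$$ $$b_h^L(w,\{q,\xi\})=\int w\cdot\nabla_{\Gamma_h}q+\int\xi\,w\cdot n_h,\qquad c_h(z;w,v)=\tfrac12\int((z\cdot\nabla_{\Gamma_h})w)\cdot v-\tfrac12\int((z\cdot\nabla_{\Gamma_h})v)\cdot w,$$ $$c_h^{cov}(z;w,v)=\tfrac12\int((z\cdot\nabla^{cov}_{\Gamma_h})w)\cdot v-\tfrac12\int((z\cdot\nabla^{cov}_{\Gamma_h})v)\cdot w-\tfrac12\int(w\cdot n_h)\,z\cdot H_hv+\tfrac12\int(v\cdot n_h)\,z\cdot H_hw,$$ $$\|w\|_{a_h}=\|E_h(w)\|_{L^2(\Gamma_h(t))}+\|w\|_{L^2(\Gamma_h(t))},\quad \mathbf V_h^{div}=\{w\in\mathbf V_h: b_h^L(w,\{q,\xi\})=0\ \ \forall q\in Q_h,\ \xi\in\Lambda_h\}.$$ **Schemes.** Let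 $\Delta t=T/N$, $t_n=n\Delta t$, write a superscript $n$ for quantities at time $t_n$, and let $f_h^n\in L^2(\Gamma_h^n)^3$. Given $u_h^0\in\mathbf V_h^{0,div}$, the functions $u_h^n\in\mathbf V_h^n$, $p_h^n\in Q_h^n$, $\lambda_h^n\in\Lambda_h^n$, $n\ge1$, solve, for all $v\in\mathbf V_h^n$, $q\in Q_h^n$, $\xi\in\Lambda_h^n$, $$\tfrac1{\Delta t}\big(m_h(u_h^n,v)-m_h(u_h^{n-1},\underline v(\cdot,t_{n-1}))\big)-g_h(u_h^n,v)+a_{S,h}(u_h^n,v)+c(\underline{u_h^{n-1}}(\cdot,t_n);u_h^n,v)+b_h^L(v,\{p_h^n,\lambda_h^n\})=m_h(f_h^n,v),$$ $$b_h^L(u_h^n,\{q,\xi\})=0,$$ where $c=c_h$ in the directional scheme and $c=c_h^{cov}$ in the covariant scheme. **Lemma (velocity estimate).** There are constants $c,h_0,\tau_0>0$, depending only on the evolving surface $(\Gamma(t))_{t\in[0,T]}$, on $k_g,k_u,k_\lambda$ and on $\rho$, such that for every such mesh with $h\le h_0$, every $N\ge1$ with $\Delta t\le\tau_0$, either scheme,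 all data and every solution as above, and every $1\le n\le N$, $$\|u_h^n\|_{L^2(\Gamma_h^n)}^2+\Delta t\sum_{k=1}^n\|u_h^k\|_{a_h}^2\le \exp(c\,t_n)\Big(\|u_h^0\|_{L^2(\Gamma_h^0)}^2+\Delta t\sum_{k=0}^n\|f_h^k\|_{L^2(\Gamma_h^k)}^2\Big).$$ In particular $c$ and $\tau_0$ do not depend on $h$, $t_n$ or the data, and no relation between $\Delta t$ and $h$ is required. -/

import Mathlib

open Matrix MeasureTheory

noncomputable section

/-- Parameter plane of the reference triangle. -/
abbrev E2 := EuclideanSpace ℝ (Fin 2)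

/-- Ambient Euclidean space. -/
abbrev E3 := EuclideanSpace ℝ (Fin 3)

/-! ### The closed evolving surface -/

/-- `p` is a closest point of `Γ` to `x`. -/
def IsClosestPoint (Γ : Set E3) (x p : E3) : Prop :=
  p ∈ Γ ∧ dist x p = Metric.infDist x Γ

/-- `Γ` is an embedded two-dimensional hypersurface (without boundary) of class `C^k`: near each of
its points it is the regular zero set of a `C^k` function. -/
def IsHypersurface (k : ℕ) (Γ : Set E3) : Prop :=
  ∀ x ∈ Γ, ∃ U : Set E3, IsOpen U ∧ x ∈ U ∧ ∃ φ : E3 → ℝ, ContDiffOn ℝ (k : WithTop ℕ∞) φ U ∧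
    (∀ y ∈ U, fderiv ℝ φ y ≠ 0) ∧ Γ ∩ U = {y ∈ U | φ y = 0}

/-- `n` is the unit normal of the hypersurface `∂Ω` at `x` that points out of `Ω`. -/
def IsOutwardUnitNormal (Ω : Set E3) (x n : E3) : Prop :=
  ‖n‖ = 1 ∧ (∀ v ∈ tangentConeAt ℝ (frontier Ω) x, inner ℝ n v = 0) ∧
    ∃ ε > 0, ∀ s ∈ Set.Ioo (0 : ℝ) ε, x + s • n ∉ closure Ω ∧ x - s • n ∈ Ω

/-- `W ∈ C¹([0,T]; C^k(Γ))`: the restriction to `Γ` of a family of fields on an open neighbourhood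
which, with its time derivative, has `k` space derivatives that are continuous in time and space. -/
def IsC1Ck (T : ℝ) (k : ℕ) (Γ : Set E3) (W : ℝ → E3 → E3) : Prop :=
  ∃ U : Set E3, IsOpen U ∧ Γ ⊆ U ∧ ∃ W₀ W₁ : ℝ → E3 → E3,
    (∀ t ∈ Set.Icc 0 T, ∀ z ∈ Γ, W₀ t z = W t z) ∧
    (∀ t ∈ Set.Icc 0 T, ContDiffOn ℝ (k : WithTop ℕ∞) (W₀ t) U) ∧
    (∀ t ∈ Set.Icc 0 T, ContDiffOn ℝ (k : WithTop ℕ∞) (W₁ t) U) ∧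
    (∀ t ∈ Set.Icc 0 T, ∀ z ∈ U,
      HasDerivWithinAt (fun s => W₀ s z) (W₁ t z) (Set.Icc 0 T) t) ∧
    (∀ j ≤ k, ContinuousOn (fun a : ℝ × E3 => iteratedFDeriv ℝ j (W₀ a.1) a.2)
      (Set.Icc 0 T ×ˢ U)) ∧
    (∀ j ≤ k, ContinuousOn (fun a : ℝ × E3 => iteratedFDeriv ℝ j (W₁ a.1) a.2)
      (Set.Icc 0 T ×ˢ U))

/-- A closed surface `Γ(t) = Φ_t(Γ₀)`, `t ∈ [0,T]`, of class `C^k` with `k ≥ 3`, which bounds an open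
set `Ω(t)` and moves with the purely normal velocity `V_Γ n`. -/
structure EvolvingSurface where
  T : ℝ
  T_pos : 0 < T
  k : ℕ
  three_le_k : 3 ≤ k
  Γ₀ : Set E3
  nonempty : Γ₀.Nonempty
  compact : IsCompact Γ₀
  hypersurface : IsHypersurface k Γ₀
  /-- the normal trajectory map `Φ` -/
  flow : ℝ → E3 → E3
  /-- the region enclosed by `Γ(t)` -/
  Ω : ℝ → Set E3
  /-- the outward unit normal of `Γ(t)` -/
  normal : ℝ → E3 → E3
  /-- the normal speed `V_Γ` -/
  speed : ℝ → E3 → ℝ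
  Ω_open : ∀ t ∈ Set.Icc 0 T, IsOpen (Ω t)
  Ω_bounded : ∀ t ∈ Set.Icc 0 T, Bornology.IsBounded (Ω t)
  Ω_frontier : ∀ t ∈ Set.Icc 0 T, frontier (Ω t) = flow t '' Γ₀
  normal_outward : ∀ t ∈ Set.Icc 0 T, ∀ x ∈ flow t '' Γ₀, IsOutwardUnitNormal (Ω t) x (normal t x)
  flow_zero : ∀ z ∈ Γ₀, flow 0 z = z
  flow_ode : ∀ t ∈ Set.Icc 0 T, ∀ z ∈ Γ₀, HasDerivWithinAt (fun s => flow s z)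
    (speed t (flow t z) • normal t (flow t z)) (Set.Icc 0 T) t
  velocity_regular : IsC1Ck T k Γ₀ fun t z => speed t (flow t z) • normal t (flow t z)
  /-- `Φ_t` has a `C^k` inverse; that `Φ_t` itself is `C^k` follows from the two fields above -/
  flow_inverse : ∀ t ∈ Set.Icc 0 T, ∃ U : Set E3, IsOpen U ∧ flow t '' Γ₀ ⊆ U ∧
    ∃ g : E3 → E3, ContDiffOn ℝ (k : WithTop ℕ∞) g U ∧ ∀ z ∈ Γ₀, g (flow t z) = z

namespace EvolvingSurface

/-- The surface `Γ(t)`. -/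
def surface (S : EvolvingSurface) (t : ℝ) : Set E3 := S.flow t '' S.Γ₀

/-- The normal material velocity `V_Γ n`. -/
def velocity (S : EvolvingSurface) (t : ℝ) (x : E3) : E3 := S.speed t x • S.normal t x

end EvolvingSurface

/-! ### The reference triangle and its Lagrange basis -/

/-- The closed reference triangle. -/
def refTriangle : Set E2 := {x | 0 ≤ x 0 ∧ 0 ≤ x 1 ∧ x 0 + x 1 ≤ 1}

/-- The open reference triangle. -/
def refInterior : Set E2 := {x | 0 < x 0 ∧ 0 < x 1 ∧ x 0 + x 1 < 1}

/-- Barycentric coordinates with respect to the reference triangle. -/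
def bary (x : E2) : Fin 3 → ℝ := ![1 - x 0 - x 1, x 0, x 1]

/-- The Lagrange basis function of degree `k` of the node with barycentric coordinates `α / k`,
`α₀ + α₁ + α₂ = k`, in the closed form `∏ᵢ binom(k bᵢ, αᵢ)`. -/
def lagrangeBasis (k : ℕ) (α : Fin 3 → ℕ) (b : Fin 3 → ℝ) : ℝ :=
  ∏ i, ∏ m ∈ Finset.range (α i), ((k : ℝ) * b i - m) / (m + 1)

/-- The polynomial map of degree `k` with prescribed values at the Lagrange nodes. -/
def lagrangeMap (k : ℕ) (a : (Fin 3 → ℕ) → E3) (x : E2) : E3 :=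
  ∑ α ∈ Finset.Nat.antidiagonalTuple 3 k, lagrangeBasis k α (bary x) • a α

/-! ### Surface differential operators in a parametrization `X`

A field `w` on the surface enters through its pull-back `w ∘ X`. -/

/-- The derivative as a matrix. -/
def jacobian (X : E2 → E3) (x : E2) : Matrix (Fin 3) (Fin 2) ℝ :=
  Matrix.of fun i a => (fderiv ℝ X x (EuclideanSpace.single a 1)) i

/-- The first fundamental form. -/
def gram (X : E2 → E3) (x : E2) : Matrix (Fin 2) (Fin 2) ℝ := (jacobian X x)ᵀ * jacobian X x

/-- The area element. -/
def areaElement (X : E2 → E3) (x : E2) : ℝ := Real.sqrt (gram X x).det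

/-- The left inverse of the Jacobian that vanishes on the normal direction. -/
def pinv (X : E2 → E3) (x : E2) : Matrix (Fin 2) (Fin 3) ℝ := (gram X x)⁻¹ * (jacobian X x)ᵀ

/-- The non-normalized normal `∂₁X × ∂₂X`. -/
def crossNormal (X : E2 → E3) (x : E2) : E3 :=
  WithLp.toLp 2 (crossProduct (fun i => jacobian X x i 0) (fun i => jacobian X x i 1))

/-- The unit normal. -/
def unitNormal (X : E2 → E3) (x : E2) : E3 := ‖crossNormal X x‖⁻¹ • crossNormal X x

/-- The projection `I - n ⊗ n` onto the tangent plane. -/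
def tangentProj (X : E2 → E3) (x : E2) : Matrix (Fin 3) (Fin 3) ℝ :=
  1 - vecMulVec (unitNormal X x).ofLp (unitNormal X x).ofLp

/-- The tangential gradient of a scalar function. -/
def scalarGrad (X : E2 → E3) (q : E2 → ℝ) (x : E2) : Fin 3 → ℝ :=
  (fun a => fderiv ℝ q x (EuclideanSpace.single a 1)) ᵥ* pinv X x

/-- The tangential gradient `∇_Γ w` of a vector field, with `(∇_Γ w)ᵢⱼ = ∂ₗ wᵢ Pₗⱼ`. -/
def surfGrad (X w : E2 → E3) (x : E2) : Matrix (Fin 3) (Fin 3) ℝ := jacobian w x * pinv X x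

/-- The covariant derivative `P ∇_Γ w`. -/
def covGrad (X w : E2 → E3) (x : E2) : Matrix (Fin 3) (Fin 3) ℝ :=
  tangentProj X x * surfGrad X w x

/-- The rate-of-strain tensor. -/
def strain (X w : E2 → E3) (x : E2) : Matrix (Fin 3) (Fin 3) ℝ :=
  (1 / 2 : ℝ) • (covGrad X w x + (covGrad X w x)ᵀ)

/-- The surface divergence. -/
def surfDiv (X w : E2 → E3) (x : E2) : ℝ := (surfGrad X w x).trace

/-- The Weingarten map. -/
def weingarten (X : E2 → E3) (x : E2) : Matrix (Fin 3) (Fin 3) ℝ := covGrad X (unitNormal X) x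

/-- The Frobenius product `A : B`. -/
def frob (A B : Matrix (Fin 3) (Fin 3) ℝ) : ℝ := ∑ i, ∑ j, A i j * B i j

/-! ### The evolving triangulation -/

/-- A triangulation: `pos` gives the initial vertices, `vert` the three vertices of each triangle,
and `node τ α` the initial position of the Lagrange node `α` (of degree `kg`) of the triangle `τ`. -/
structure Mesh (kg : ℕ) where
  nV : ℕ
  nT : ℕ
  pos : Fin nV → E3
  vert : Fin nT → Fin 3 → Fin nV
  node : Fin nT → (Fin 3 → ℕ) → E3

namespace Mesh

variable {kg : ℕ}

/-- The reference map of the element `τ(t)`: the nodes move with the flow of the surface. -/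
def elementMap (M : Mesh kg) (S : EvolvingSurface) (τ : Fin M.nT) (t : ℝ) : E2 → E3 :=
  lagrangeMap kg fun α => S.flow t (M.node τ α)

/-- The (curved) closed element `τ(t)`. -/
def element (M : Mesh kg) (S : EvolvingSurface) (τ : Fin M.nT) (t : ℝ) : Set E3 :=
  M.elementMap S τ t '' refTriangle

/-- The discrete surface `Γ_h(t)`. -/
def surface (M : Mesh kg) (S : EvolvingSurface) (t : ℝ) : Set E3 := ⋃ τ, M.element S τ t

/-- The discrete material velocity on `τ(t)`, pulled back to the reference triangle: the Lagrange
interpolant of the velocity of `Γ(t)`, which is the velocity `∂ₜ` of the points of `elementMap`. -/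
def velocity (M : Mesh kg) (S : EvolvingSurface) (τ : Fin M.nT) (t : ℝ) : E2 → E3 :=
  lagrangeMap kg fun α => S.velocity t (S.flow t (M.node τ α))

/-- The weight that the point of the triangle `τ` with reference coordinate `x` gives to the
vertex `v`. -/
def vertexWeight (M : Mesh kg) (τ : Fin M.nT) (x : E2) (v : Fin M.nV) : ℝ :=
  ∑ i, if M.vert τ i = v then bary x i else 0

/-- The `kg`-th order Lagrange interpolation of the surface over a triangulation with vertices on
`Γ₀`, whose evolution is an embedded conforming triangulated surface near `Γ(t)` at each time. -/
structure IsAdmissible (M : Mesh kg) (S : EvolvingSurface) : Prop where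
  pos_mem : ∀ v, M.pos v ∈ S.Γ₀
  vert_injective : ∀ τ, Function.Injective (M.vert τ)
  range_injective : ∀ τ σ, Set.range (M.vert τ) = Set.range (M.vert σ) → τ = σ
  /-- the nodes are the closest-point projections of the Lagrange nodes of the flat triangles -/
  node_closest : ∀ τ, ∀ α ∈ Finset.Nat.antidiagonalTuple 3 kg,
    IsClosestPoint S.Γ₀ (∑ i, ((α i : ℝ) / kg) • M.pos (M.vert τ i)) (M.node τ α)
  /-- elements meet exactly along their common vertices and edges -/
  conforming : ∀ t ∈ Set.Icc 0 S.T, ∀ τ σ, ∀ x ∈ refTriangle, ∀ y ∈ refTriangle,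
    (M.elementMap S τ t x = M.elementMap S σ t y ↔ M.vertexWeight τ x = M.vertexWeight σ y)
  /-- the closest-point projection is well defined on `Γ_h(t)` ... -/
  closest_unique : ∀ t ∈ Set.Icc 0 S.T, ∀ x ∈ M.surface S t, ∃! p, IsClosestPoint (S.surface t) x p
  /-- ... and a bijection from `Γ_h(t)` onto `Γ(t)` -/
  closest_bijective : ∀ t ∈ Set.Icc 0 S.T, ∀ p ∈ S.surface t,
    ∃! x, x ∈ M.surface S t ∧ IsClosestPoint (S.surface t) x p
  /-- the vertices are numbered so that `unitNormal` is the outward normal of `Γ_h(t)` -/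
  oriented : ∀ t ∈ Set.Icc 0 S.T, ∀ τ, ∀ x ∈ refTriangle, ∀ p,
    IsClosestPoint (S.surface t) (M.elementMap S τ t x) p →
      0 < inner ℝ (crossNormal (M.elementMap S τ t) x) (S.normal t p)

/-- The mesh size: the supremum over `[0,T]` of the largest element diameter. -/
def meshSize (M : Mesh kg) (S : EvolvingSurface) : ℝ :=
  sSup {d | ∃ t ∈ Set.Icc 0 S.T, ∃ τ, d = Metric.diam (M.element S τ t)}

/-- At each time every triangle (with the vertices of the element) is non-degenerate and contains a
two-dimensional disc of radius `ρ h`. -/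
def IsUniformlyQuasiUniform (M : Mesh kg) (S : EvolvingSurface) (ρ : ℝ) : Prop :=
  ∀ t ∈ Set.Icc 0 S.T, ∀ τ, AffineIndependent ℝ (fun i => S.flow t (M.pos (M.vert τ i))) ∧
    ∃ z ∈ affineSpan ℝ (Set.range fun i => S.flow t (M.pos (M.vert τ i))),
      Metric.closedBall z (ρ * M.meshSize S) ∩
          affineSpan ℝ (Set.range fun i => S.flow t (M.pos (M.vert τ i))) ⊆
        convexHull ℝ (Set.range fun i => S.flow t (M.pos (M.vert τ i)))

/-! ### Finite element functions

Functions on `Γ_h(t)` are functions on `E3` whose values off `Γ_h(t)` are irrelevant. -/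

/-- `v ∈ S_h^k(t)`. -/
def IsFE (M : Mesh kg) (S : EvolvingSurface) (k : ℕ) (t : ℝ) (v : E3 → ℝ) : Prop :=
  ContinuousOn v (M.surface S t) ∧ ∀ τ, ∃ P : MvPolynomial (Fin 2) ℝ, P.totalDegree ≤ k ∧
    ∀ x ∈ refTriangle, v (M.elementMap S τ t x) = MvPolynomial.eval x.ofLp P

/-- `w ∈ (S_h^k(t))³`. -/
def IsVectorFE (M : Mesh kg) (S : EvolvingSurface) (k : ℕ) (t : ℝ) (w : E3 → E3) : Prop :=
  ∀ i, M.IsFE S k t fun y => w y i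

open Classical in
/-- The time-lift to `Γ_h(t)` of a finite element function on `Γ_h(s)`: the function with the same
nodal values, i.e. with the same pull-backs to the reference triangle. -/
def timeLift (M : Mesh kg) (S : EvolvingSurface) (s t : ℝ) (z : E3 → E3) (y : E3) : E3 :=
  if h : ∃ a : Fin M.nT × E2, a.2 ∈ refTriangle ∧ M.elementMap S a.1 t a.2 = y then
    z (M.elementMap S h.choose.1 s h.choose.2)
  else 0

/-- The surface integral over `Γ_h(t)` of a function given on the elements in reference
coordinates. -/
def integral (M : Mesh kg) (S : EvolvingSurface) (t : ℝ) (g : Fin M.nT → E2 → ℝ) : ℝ :=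
  ∑ τ, ∫ x in refInterior, g τ x * areaElement (M.elementMap S τ t) x

/-- `q ∈ Q_h(t)`: degree `k_u - 1` and mean value zero. -/
def IsPressure (M : Mesh kg) (S : EvolvingSurface) (ku : ℕ) (t : ℝ) (q : E3 → ℝ) : Prop :=
  M.IsFE S (ku - 1) t q ∧ M.integral S t (fun τ x => q (M.elementMap S τ t x)) = 0

/-- `f ∈ L²(Γ_h(t))³`. -/
def MemL2 (M : Mesh kg) (S : EvolvingSurface) (t : ℝ) (f : E3 → E3) : Prop :=
  ∀ τ, AEStronglyMeasurable (f ∘ M.elementMap S τ t) (volume.restrict refInterior) ∧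
    IntegrableOn (fun x => ‖f (M.elementMap S τ t x)‖ ^ 2 * areaElement (M.elementMap S τ t) x)
      refInterior

/-! ### The discrete forms -/

/-- `m_h(t; w, v)`. -/
def massForm (M : Mesh kg) (S : EvolvingSurface) (t : ℝ) (w v : E3 → E3) : ℝ :=
  M.integral S t fun τ x => inner ℝ (w (M.elementMap S τ t x)) (v (M.elementMap S τ t x))

/-- `g_h(t; V_h; w, v)`. -/
def divForm (M : Mesh kg) (S : EvolvingSurface) (t : ℝ) (w v : E3 → E3) : ℝ :=
  M.integral S t fun τ x => surfDiv (M.elementMap S τ t) (M.velocity S τ t) x *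
    inner ℝ (w (M.elementMap S τ t x)) (v (M.elementMap S τ t x))

/-- `a_{S,h}(t; w, v)`. -/
def strainForm (M : Mesh kg) (S : EvolvingSurface) (t : ℝ) (w v : E3 → E3) : ℝ :=
  M.integral S t fun τ x =>
    frob (strain (M.elementMap S τ t) (w ∘ M.elementMap S τ t) x)
      (strain (M.elementMap S τ t) (v ∘ M.elementMap S τ t) x)

/-- `∫ ((z · ∇_{Γ_h}) w) · v`. -/
def dirConv (M : Mesh kg) (S : EvolvingSurface) (t : ℝ) (z w v : E3 → E3) : ℝ :=
  M.integral S t fun τ x =>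
    (surfGrad (M.elementMap S τ t) (w ∘ M.elementMap S τ t) x *ᵥ
      (z (M.elementMap S τ t x)).ofLp) ⬝ᵥ (v (M.elementMap S τ t x)).ofLp

/-- `∫ ((z · ∇^{cov}_{Γ_h}) w) · v`. -/
def covConv (M : Mesh kg) (S : EvolvingSurface) (t : ℝ) (z w v : E3 → E3) : ℝ :=
  M.integral S t fun τ x =>
    (covGrad (M.elementMap S τ t) (w ∘ M.elementMap S τ t) x *ᵥ
      (z (M.elementMap S τ t x)).ofLp) ⬝ᵥ (v (M.elementMap S τ t x)).ofLp

/-- `∫ (w · n_h) (z · H_h v)`. -/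
def curvConv (M : Mesh kg) (S : EvolvingSurface) (t : ℝ) (z w v : E3 → E3) : ℝ :=
  M.integral S t fun τ x =>
    inner ℝ (w (M.elementMap S τ t x)) (unitNormal (M.elementMap S τ t) x) *
      ((z (M.elementMap S τ t x)).ofLp ⬝ᵥ
        (weingarten (M.elementMap S τ t) x *ᵥ (v (M.elementMap S τ t x)).ofLp))

end Mesh

/-- The two schemes: with the directional or with the covariant convective term. -/
inductive Convection
  | directional
  | covariant

namespace Mesh

variable {kg : ℕ}

/-- The skew-symmetrized convective forms `c_h(t; z; w, v)` and `c_h^{cov}(t; z; w, v)`. -/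
def convForm (M : Mesh kg) (S : EvolvingSurface) (t : ℝ) :
    Convection → (E3 → E3) → (E3 → E3) → (E3 → E3) → ℝ
  | .directional, z, w, v => 1 / 2 * (M.dirConv S t z w v - M.dirConv S t z v w)
  | .covariant, z, w, v => 1 / 2 * (M.covConv S t z w v - M.covConv S t z v w) -
      1 / 2 * (M.curvConv S t z w v - M.curvConv S t z v w)

/-- `b_h^L(t; w, {q, ξ})`. -/
def lagrangeForm (M : Mesh kg) (S : EvolvingSurface) (t : ℝ) (w : E3 → E3) (q ξ : E3 → ℝ) : ℝ :=
  M.integral S t (fun τ x => (w (M.elementMap S τ t x)).ofLp ⬝ᵥ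
      scalarGrad (M.elementMap S τ t) (q ∘ M.elementMap S τ t) x) +
    M.integral S t fun τ x => ξ (M.elementMap S τ t x) *
      inner ℝ (w (M.elementMap S τ t x)) (unitNormal (M.elementMap S τ t) x)

/-- The norm of `L²(Γ_h(t))`. -/
def l2Norm (M : Mesh kg) (S : EvolvingSurface) (t : ℝ) (w : E3 → E3) : ℝ :=
  Real.sqrt (M.massForm S t w w)

/-- The energy norm `‖E_h(w)‖_{L²} + ‖w‖_{L²}`. -/
def energyNorm (M : Mesh kg) (S : EvolvingSurface) (t : ℝ) (w : E3 → E3) : ℝ :=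
  Real.sqrt (M.strainForm S t w w) + M.l2Norm S t w

/-- `w ∈ V_h^{div}(t)`: a velocity of degree `ku`, weakly tangential and divergence-free. -/
def IsWeaklyDivFree (M : Mesh kg) (S : EvolvingSurface) (ku kl : ℕ) (t : ℝ) (w : E3 → E3) : Prop :=
  M.IsVectorFE S ku t w ∧ ∀ q ξ, M.IsPressure S ku t q → M.IsFE S kl t ξ →
    M.lagrangeForm S t w q ξ = 0

/-- The solutions `(uⁿ, pⁿ, λⁿ)` of the fully discrete schemes with time step `dt`, up to the
time level `N`. -/
structure IsDiscreteSolution (M : Mesh kg) (S : EvolvingSurface) (ku kl : ℕ) (form : Convection)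
    (N : ℕ) (dt : ℝ) (f u : ℕ → E3 → E3) (p lam : ℕ → E3 → ℝ) : Prop where
  initial : M.IsWeaklyDivFree S ku kl 0 (u 0)
  velocity_mem : ∀ n ∈ Finset.Icc 1 N, M.IsVectorFE S ku (n * dt) (u n)
  pressure_mem : ∀ n ∈ Finset.Icc 1 N, M.IsPressure S ku (n * dt) (p n)
  multiplier_mem : ∀ n ∈ Finset.Icc 1 N, M.IsFE S kl (n * dt) (lam n)
  momentum : ∀ n ∈ Finset.Icc 1 N, ∀ v, M.IsVectorFE S ku (n * dt) v →
    1 / dt * (M.massForm S (n * dt) (u n) v -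
        M.massForm S ((n - 1 : ℕ) * dt) (u (n - 1))
          (M.timeLift S (n * dt) ((n - 1 : ℕ) * dt) v)) -
      M.divForm S (n * dt) (u n) v + M.strainForm S (n * dt) (u n) v +
      M.convForm S (n * dt) form (M.timeLift S ((n - 1 : ℕ) * dt) (n * dt) (u (n - 1))) (u n) v +
      M.lagrangeForm S (n * dt) v (p n) (lam n) = M.massForm S (n * dt) (f n) v
  constraint : ∀ n ∈ Finset.Icc 1 N, ∀ q ξ, M.IsPressure S ku (n * dt) q →
    M.IsFE S kl (n * dt) ξ → M.lagrangeForm S (n * dt) (u n) q ξ = 0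

end Mesh

end

/-! ### Lagrange interpolation on the reference triangle -/

/-! Test the momentum equation with the new velocity itself. The convective forms are skew and
vanish (`Mesh.convForm_self`), and the constraint removes the pressure and the multiplier. What
remains is an implicit Euler energy balance on a moving domain. Young's inequality splits the mixed
mass term into the old mass and the mass of the new velocity lifted back to the old surface. The
lift keeps pull-backs, so the two masses of the new velocity differ only through the area elements.
If |div V_h| ≤ C, the area elements at times s ≤ t satisfy a(s) ≤ exp(C(t-s)) a(t), and the
divergence term costs at most C times the mass. `implicit_discrete_gronwall` concludes.

All the work is in making C independent of the mesh. On the reference triangle it suffices that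
|DV_h ξ| ≤ C |DX ξ| for the element map X (`Mesh.exists_norm_fderiv_velocity_le`, `abs_surfDiv_le`).
The right side is at least a multiple of h|ξ|: a flat triangle containing a disc of radius ρh has
affine parametrization with derivative at least ρh/2, and X deviates from it by only a small
multiple of h. The left side is at most a multiple of h|ξ|, because the velocity is Lipschitz in the
initial position. The powers of h cancel, so no inverse estimate and no coupling of the time step to
h enters.

The deviation from affine is needed only as o(h), so strict differentiability of the local defining
function and of the velocity, made uniform by compactness, is enough (`exists_near_affine`). The
flow carries the nodal deviation to later times. -/

theorem succ_mul_choose_succ (x : ℝ) (n : ℕ) :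
    ((n : ℝ) + 1) * Ring.choose x (n + 1) = x * Ring.choose (x - 1) n := by
  simpa using Ring.choose_add_smul_choose (x - 1) n 1

theorem prod_range_sub_div_eq_choose (x : ℝ) (n : ℕ) :
    ∏ m ∈ Finset.range n, (x - m) / (m + 1) = Ring.choose x n := by
  induction n with
  | zero => simp
  | succ n ih =>
    have h : ((n : ℝ) + 1) * Ring.choose (x + 1) (n + 1) = (x + 1) * Ring.choose x n := by
      simpa using succ_mul_choose_succ (x + 1) n
    rw [Ring.choose_succ_succ] at h
    rw [Finset.prod_range_succ, ih]
    have : (n : ℝ) + 1 ≠ 0 := by positivity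
    field_simp
    linarith

theorem sum_antidiagonal_choose_mul (x y : ℝ) (n : ℕ) :
    ∑ p ∈ Finset.HasAntidiagonal.antidiagonal n, Ring.choose x p.1 * Ring.choose y p.2 = Ring.choose (x + y) n :=
  (Ring.add_choose_eq n (Commute.all x y)).symm

theorem sum_antidiagonal_fst_mul_choose_mul (x y : ℝ) (n : ℕ) :
    ∑ p ∈ Finset.HasAntidiagonal.antidiagonal (n + 1), (p.1 : ℝ) * Ring.choose x p.1 * Ring.choose y p.2 =
      x * Ring.choose (x + y - 1) n := by
  rw [Finset.Nat.antidiagonal_succ, Finset.sum_cons]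
  simp only [Nat.cast_zero, zero_mul, zero_add, Finset.sum_map]
  rw [show x + y - 1 = (x - 1) + y by ring, ← sum_antidiagonal_choose_mul, Finset.mul_sum]
  refine Finset.sum_congr rfl fun p _ => ?_
  have := succ_mul_choose_succ x p.1
  simp [this, mul_assoc]

theorem mem_antidiagonalTuple_three {k : ℕ} {α : Fin 3 → ℕ} :
    α ∈ Finset.Nat.antidiagonalTuple 3 k ↔ α 0 + α 1 + α 2 = k := by
  rw [Finset.Nat.mem_antidiagonalTuple, Fin.sum_univ_three]

theorem sum_antidiagonalTuple_three (k : ℕ) (f : (Fin 3 → ℕ) → ℝ) :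
    ∑ α ∈ Finset.Nat.antidiagonalTuple 3 k, f α =
      ∑ p ∈ Finset.HasAntidiagonal.antidiagonal k, ∑ q ∈ Finset.HasAntidiagonal.antidiagonal p.2, f ![p.1, q.1, q.2] := by
  rw [Finset.sum_sigma']
  refine Finset.sum_bij' (fun α _ => ⟨(α 0, α 1 + α 2), (α 1, α 2)⟩)
    (fun s _ => ![s.1.1, s.2.1, s.2.2]) ?_ ?_ ?_ ?_ ?_
  · intro α hα
    rw [mem_antidiagonalTuple_three] at hα
    simp; omega
  · rintro ⟨⟨a, b⟩, ⟨c, d⟩⟩ h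
    simp at h
    rw [mem_antidiagonalTuple_three]
    simp; omega
  · intro α _
    ext i; fin_cases i <;> rfl
  · rintro ⟨⟨a, b⟩, ⟨c, d⟩⟩ h
    simp at h
    obtain ⟨_, rfl⟩ := h
    simp
  · intro α _
    congr 1
    ext i; fin_cases i <;> rfl

/-- Absorption turns α_i · binom(x_i, α_i) into x_i · binom(x_i - 1, α_i - 1); the Vandermonde
convolution then collapses the sum. The swap of 0 and i reduces every index to the first. -/
theorem sum_antidiagonalTuple_mul_prod_choose (k : ℕ) (x : Fin 3 → ℝ) (i : Fin 3) :
    ∑ α ∈ Finset.Nat.antidiagonalTuple 3 (k + 1), (α i : ℝ) * ∏ j, Ring.choose (x j) (α j) =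
      x i * Ring.choose (∑ j, x j - 1) k := by
  have first : ∀ y : Fin 3 → ℝ, ∑ α ∈ Finset.Nat.antidiagonalTuple 3 (k + 1),
      (α 0 : ℝ) * ∏ j, Ring.choose (y j) (α j) = y 0 * Ring.choose (∑ j, y j - 1) k := by
    intro y
    rw [sum_antidiagonalTuple_three, Fin.sum_univ_three, add_assoc,
      ← sum_antidiagonal_fst_mul_choose_mul]
    refine Finset.sum_congr rfl fun p _ => ?_
    rw [← sum_antidiagonal_choose_mul, Finset.mul_sum]
    refine Finset.sum_congr rfl fun q _ => ?_
    simp [Fin.prod_univ_three]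
    ring
  have h := first (x ∘ Equiv.swap 0 i)
  simp only [Function.comp_apply, Equiv.swap_apply_left, Equiv.sum_comp (Equiv.swap 0 i) x] at h
  rw [← h]
  refine Finset.sum_bij' (fun α _ => α ∘ Equiv.swap 0 i) (fun α _ => α ∘ Equiv.swap 0 i)
    ?_ ?_ ?_ ?_ ?_
  · intro α hα
    rw [Finset.Nat.mem_antidiagonalTuple] at hα ⊢
    simpa only [Function.comp_apply, Equiv.sum_comp (Equiv.swap 0 i) α] using hα
  · intro α hα
    rw [Finset.Nat.mem_antidiagonalTuple] at hα ⊢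
    simpa only [Function.comp_apply, Equiv.sum_comp (Equiv.swap 0 i) α] using hα
  · intro α _; ext j; simp
  · intro α _; ext j; simp
  · intro α _
    simp only [Function.comp_apply, Equiv.swap_apply_left]
    rw [Equiv.prod_comp (Equiv.swap 0 i) fun j => Ring.choose (x j) (α j)]

theorem sum_bary (x : E2) : ∑ i, bary x i = 1 := by
  simp [bary, Fin.sum_univ_three]
  ring

theorem lagrangeBasis_eq_prod_choose (k : ℕ) (α : Fin 3 → ℕ) (b : Fin 3 → ℝ) :
    lagrangeBasis k α b = ∏ i, Ring.choose ((k : ℝ) * b i) (α i) := by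
  simp only [lagrangeBasis, prod_range_sub_div_eq_choose]

/-- With x = k · bary the arguments sum to k, so the collapsed binomial is binom(k - 1, k - 1) = 1.
This is the exactness of Lagrange interpolation on affine functions. -/
theorem sum_lagrangeBasis_mul_div {k : ℕ} (hk : 1 ≤ k) (x : E2) (i : Fin 3) :
    ∑ α ∈ Finset.Nat.antidiagonalTuple 3 k, lagrangeBasis k α (bary x) * ((α i : ℝ) / k) =
      bary x i := by
  obtain ⟨n, rfl⟩ : ∃ n, k = n + 1 := ⟨k - 1, by omega⟩
  have h := sum_antidiagonalTuple_mul_prod_choose n (fun j => ((n + 1 : ℕ) : ℝ) * bary x j) i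
  rw [← Finset.mul_sum, sum_bary, mul_one,
    show ((n + 1 : ℕ) : ℝ) - 1 = n by push_cast; ring, Ring.choose_natCast, Nat.choose_self,
    Nat.cast_one, mul_one] at h
  have hn : ((n + 1 : ℕ) : ℝ) ≠ 0 := by positivity
  simp only [lagrangeBasis_eq_prod_choose, ← mul_div_assoc, ← Finset.sum_div]
  rw [div_eq_iff hn, mul_comm (bary x i), ← h]
  exact Finset.sum_congr rfl fun α _ => mul_comm _ _

/-- The affine map with the given values at the corners of the reference triangle. -/
noncomputable def affineInterp (w : Fin 3 → E3) (x : E2) : E3 := ∑ i, bary x i • w i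

/-- The value of `affineInterp w` at a Lagrange node. -/
noncomputable def flatNode (k : ℕ) (w : Fin 3 → E3) (α : Fin 3 → ℕ) : E3 := ∑ i, ((α i : ℝ) / k) • w i

theorem lagrangeMap_flatNode {k : ℕ} (hk : 1 ≤ k) (w : Fin 3 → E3) (x : E2) :
    lagrangeMap k (flatNode k w) x = affineInterp w x := by
  simp only [lagrangeMap, flatNode, affineInterp, Finset.smul_sum, smul_smul]
  rw [Finset.sum_comm]
  refine Finset.sum_congr rfl fun i _ => ?_
  rw [← Finset.sum_smul, sum_lagrangeBasis_mul_div hk]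

/-- The reference coordinates of the corners. -/
noncomputable def corner (i : Fin 3) : E2 := !₂[if i = 1 then 1 else 0, if i = 2 then 1 else 0]

theorem corner_mem (i : Fin 3) : corner i ∈ refTriangle := by
  fin_cases i <;> simp [corner, refTriangle]

theorem bary_corner (i j : Fin 3) : bary (corner i) j = if j = i then 1 else 0 := by
  fin_cases i <;> fin_cases j <;> simp [corner, bary]

theorem lagrangeMap_corner (k : ℕ) (a : (Fin 3 → ℕ) → E3) (i : Fin 3) :
    lagrangeMap k a (corner i) = a (Pi.single i k) := by
  rw [lagrangeMap, Finset.sum_eq_single (Pi.single i k)]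
  · rw [lagrangeBasis_eq_prod_choose, Finset.prod_eq_one, one_smul]
    intro j _
    by_cases h : j = i
    · subst h; simp [bary_corner, Ring.choose_natCast]
    · simp [bary_corner, h]
  · intro α hα hne
    rw [lagrangeBasis_eq_prod_choose]
    obtain ⟨j, hji, hj⟩ : ∃ j, j ≠ i ∧ α j ≠ 0 := by
      by_contra! hcon
      apply hne
      rw [Finset.Nat.mem_antidiagonalTuple, Finset.sum_eq_single i (fun j _ h => hcon j h)
        (by simp)] at hα
      ext j
      by_cases h : j = i
      · subst h; simpa using hα
      · simp [h, hcon j h]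
    rw [Finset.prod_eq_zero (Finset.mem_univ j), zero_smul]
    rw [bary_corner, if_neg hji, mul_zero]
    exact Ring.choose_zero_pos _ (Nat.pos_of_ne_zero hj)
  · intro h
    exact absurd (by rw [Finset.Nat.mem_antidiagonalTuple]; simp) h

/-! ### Smoothness and derivative bounds for interpolants. -/

theorem contDiff_bary (i : Fin 3) : ContDiff ℝ ⊤ fun x : E2 => bary x i := by
  fin_cases i <;> simp only [bary] <;> simp <;> fun_prop

theorem contDiff_lagrangeBasis (k : ℕ) (α : Fin 3 → ℕ) :
    ContDiff ℝ ⊤ fun x : E2 => lagrangeBasis k α (bary x) := by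
  unfold lagrangeBasis
  refine contDiff_prod fun i _ => contDiff_prod fun m _ => ?_
  exact ((contDiff_const.mul (contDiff_bary i)).sub contDiff_const).div_const _

theorem contDiff_lagrangeMap (k : ℕ) (a : (Fin 3 → ℕ) → E3) :
    ContDiff ℝ ⊤ (lagrangeMap k a) := by
  unfold lagrangeMap
  exact ContDiff.sum fun α _ => (contDiff_lagrangeBasis k α).smul contDiff_const

theorem isCompact_refTriangle : IsCompact refTriangle := by
  refine Metric.isCompact_of_isClosed_isBounded ?_ ?_
  · have : refTriangle = {x : E2 | 0 ≤ x 0} ∩ ({x : E2 | 0 ≤ x 1} ∩ {x : E2 | x 0 + x 1 ≤ 1}) := rfl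
    rw [this]
    refine (isClosed_le (by fun_prop) (by fun_prop)).inter
      ((isClosed_le (by fun_prop) (by fun_prop)).inter
        (isClosed_le (by fun_prop) (by fun_prop)))
  · refine (Metric.isBounded_closedBall (x := (0 : E2)) (r := 2)).subset fun x hx => ?_
    obtain ⟨h0, h1, h2⟩ := hx
    rw [mem_closedBall_zero_iff, EuclideanSpace.norm_eq, Real.sqrt_le_left (by norm_num)]
    simp [Fin.sum_univ_two]
    nlinarith

theorem fderiv_lagrangeMap_apply (k : ℕ) (a : (Fin 3 → ℕ) → E3) (x ξ : E2) :
    fderiv ℝ (lagrangeMap k a) x ξ = ∑ α ∈ Finset.Nat.antidiagonalTuple 3 k,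
      (fderiv ℝ (fun y : E2 => lagrangeBasis k α (bary y)) x ξ) • a α := by
  have h : HasFDerivAt (lagrangeMap k a) (∑ α ∈ Finset.Nat.antidiagonalTuple 3 k,
      (fderiv ℝ (fun y : E2 => lagrangeBasis k α (bary y)) x).smulRight (a α)) x := by
    unfold lagrangeMap
    refine HasFDerivAt.fun_sum fun α _ => ?_
    exact (((contDiff_lagrangeBasis k α).differentiable (by simp)) x).hasFDerivAt.smul_const (a α)
  rw [h.fderiv]
  simp

/-- The basis functions live on one fixed compact triangle, so the constant depends on the degree
alone. Applied to nodal deviations from an affine map, it bounds the deviation of the derivative. -/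
theorem exists_norm_fderiv_lagrangeMap_le (k : ℕ) : ∃ B > 0, ∀ a : (Fin 3 → ℕ) → E3, ∀ d : ℝ,
    (∀ α ∈ Finset.Nat.antidiagonalTuple 3 k, ‖a α‖ ≤ d) → ∀ x ∈ refTriangle, ∀ ξ,
      ‖fderiv ℝ (lagrangeMap k a) x ξ‖ ≤ B * d * ‖ξ‖ := by
  have h : ∀ α, ∃ C, ∀ x ∈ refTriangle,
      ‖fderiv ℝ (fun y : E2 => lagrangeBasis k α (bary y)) x‖ ≤ C := fun α =>
    isCompact_refTriangle.exists_bound_of_continuousOn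
      ((contDiff_lagrangeBasis k α).continuous_fderiv (by simp)).continuousOn
  choose C hC using h
  refine ⟨∑ α ∈ Finset.Nat.antidiagonalTuple 3 k, |C α| + 1,
    by positivity, fun a d ha x hx ξ => ?_⟩
  have hd : 0 ≤ d := by
    have hm : (Pi.single 0 k : Fin 3 → ℕ) ∈ Finset.Nat.antidiagonalTuple 3 k := by
      rw [Finset.Nat.mem_antidiagonalTuple]; simp
    exact (norm_nonneg _).trans (ha _ hm)
  rw [fderiv_lagrangeMap_apply]
  calc _ ≤ ∑ α ∈ Finset.Nat.antidiagonalTuple 3 k, |C α| * d * ‖ξ‖ := by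
        refine norm_sum_le_of_le _ fun α hα => ?_
        rw [norm_smul, mul_right_comm]
        refine mul_le_mul ?_ (ha α hα) (norm_nonneg _) (by positivity)
        refine (ContinuousLinearMap.le_opNorm _ _).trans ?_
        gcongr
        exact (hC α x hx).trans (le_abs_self _)
    _ ≤ _ := by
        rw [← Finset.sum_mul, ← Finset.sum_mul]
        gcongr
        linarith

theorem fderiv_affineInterp (w : Fin 3 → E3) (x ξ : E2) :
    fderiv ℝ (affineInterp w) x ξ = ξ 0 • (w 1 - w 0) + ξ 1 • (w 2 - w 0) := by
  have h : affineInterp w = fun y => w 0 +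
      ((EuclideanSpace.proj (0 : Fin 2) : E2 →L[ℝ] ℝ).smulRight (w 1 - w 0) +
        (EuclideanSpace.proj (1 : Fin 2) : E2 →L[ℝ] ℝ).smulRight (w 2 - w 0)) y := by
    ext y
    simp [affineInterp, bary, Fin.sum_univ_three]
    ring
  rw [h, fderiv_const_add, ContinuousLinearMap.fderiv]
  simp

theorem affineInterp_sub (w : Fin 3 → E3) (x y : E2) :
    affineInterp w y - affineInterp w x = (y - x) 0 • (w 1 - w 0) + (y - x) 1 • (w 2 - w 0) := by
  ext i
  simp [affineInterp, bary, Fin.sum_univ_three]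
  ring

/-- Interpolation is linear in the nodal values and exact on affine maps, so all comparisons with
the flat triangle reduce to estimates at nodes. -/
theorem fderiv_lagrangeMap_sub_affine {k : ℕ} (hk : 1 ≤ k) (a : (Fin 3 → ℕ) → E3)
    (w : Fin 3 → E3) (x ξ : E2) :
    fderiv ℝ (lagrangeMap k a) x ξ - fderiv ℝ (affineInterp w) x ξ =
      fderiv ℝ (lagrangeMap k fun α => a α - flatNode k w α) x ξ := by
  rw [show affineInterp w = lagrangeMap k (flatNode k w) from
    (funext fun x => lagrangeMap_flatNode hk w x).symm]
  simp only [fderiv_lagrangeMap_apply, smul_sub, Finset.sum_sub_distrib]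

/-! ### Interpolation nodes near a hypersurface -/

theorem norm_sum_smul_sub_le {b : Fin 3 → ℝ} (hb : ∀ i, 0 ≤ b i) (hb1 : ∑ i, b i = 1)
    (v : Fin 3 → E3) (p : E3) {h : ℝ} (hv : ∀ i, ‖v i - p‖ ≤ h) :
    ‖∑ i, b i • v i - p‖ ≤ h := by
  have h1 : ∑ i, b i • v i - p = ∑ i, b i • (v i - p) := by
    simp only [smul_sub, Finset.sum_sub_distrib, ← Finset.sum_smul, hb1, one_smul]
  rw [h1]
  calc _ ≤ ∑ i, b i * h := norm_sum_le_of_le _ fun i _ => by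
        rw [norm_smul, Real.norm_of_nonneg (hb i)]
        exact mul_le_mul_of_nonneg_left (hv i) (hb i)
    _ = h := by rw [← Finset.sum_mul, hb1, one_mul]

/-- The defining function φ vanishes at the vertices, so by strict differentiability at `x` its
differential is almost zero along the edges, and φ = O(ηh) at any point of the flat triangle. A
shift of length O(ηh) along a transversal direction changes the sign of φ, and the intermediate
value theorem yields a nearby point of Γ. -/
theorem IsHypersurface.exists_infDist_le {k : ℕ} (hk : 1 ≤ k) {Γ : Set E3}
    (hΓ : IsHypersurface k Γ) {x : E3} (hx : x ∈ Γ) {ε : ℝ} (hε : 0 < ε) :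
    ∃ r > 0, ∀ v : Fin 3 → E3, (∀ i, v i ∈ Γ ∧ v i ∈ Metric.ball x r) → ∀ h,
      (∀ i j, ‖v i - v j‖ ≤ h) → ∀ b : Fin 3 → ℝ, (∀ i, 0 ≤ b i) → ∑ i, b i = 1 →
        Metric.infDist (∑ i, b i • v i) Γ ≤ ε * h := by
  -- One may assume h ≤ r: vertices in a ball of radius r/2 are at distance less than r, so h may be
  -- replaced by min h r. This keeps the transversal shift inside the ball.
  suffices H : ∃ r > 0, ∀ v : Fin 3 → E3, (∀ i, v i ∈ Γ ∧ v i ∈ Metric.ball x r) → ∀ h ≤ r,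
      (∀ i j, ‖v i - v j‖ ≤ h) → ∀ b : Fin 3 → ℝ, (∀ i, 0 ≤ b i) → ∑ i, b i = 1 →
        Metric.infDist (∑ i, b i • v i) Γ ≤ ε * h by
    obtain ⟨r, hr, H⟩ := H
    refine ⟨r / 2, by positivity, fun v hv h hdist b hb hb1 =>
      (H v (fun i => ⟨(hv i).1, Metric.ball_subset_ball (by linarith) (hv i).2⟩) (min h r)
        (min_le_right _ _) (fun i j => le_min (hdist i j) ?_) b hb hb1).trans
        (by gcongr; exact min_le_left _ _)⟩
    rw [← dist_eq_norm]
    have h1 := Metric.mem_ball.1 (hv i).2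
    have h2 := Metric.mem_ball.1 (hv j).2
    linarith [dist_triangle_right (v i) (v j) x]
  obtain ⟨U, hU, hxU, φ, hφ, hφ', hΓU⟩ := hΓ x hx
  have hat : ContDiffAt ℝ (k : WithTop ℕ∞) φ x := hφ.contDiffAt (hU.mem_nhds hxU)
  have hstrict := hat.hasStrictFDerivAt (by simp; omega)
  set L := fderiv ℝ φ x with hL
  obtain ⟨g, hg⟩ : ∃ g, L g = 1 := by
    obtain ⟨w, hw⟩ : ∃ w, L w ≠ 0 := by
      by_contra! hcon
      exact hφ' x hxU (ContinuousLinearMap.ext hcon)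
    exact ⟨(L w)⁻¹ • w, by simp [hw]⟩
  -- The first bound gives φ slope between 1/2 and 3/2 along `g`; the second makes the final shift
  -- 4ηh‖g‖ at most εh.
  set η := min (1 / (2 * (‖g‖ + 1))) (ε / (4 * (‖g‖ + 1))) with hη
  have hg0 := norm_nonneg g
  have hη0 : 0 < η := by positivity
  have hη1 : η * ‖g‖ ≤ 1 / 2 := by
    have h1 : η * (2 * (‖g‖ + 1)) ≤ 1 := (le_div_iff₀ (by positivity)).1 (min_le_left _ _)
    nlinarith
  have hη2 : 4 * η * ‖g‖ ≤ ε := by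
    have h1 : η * (4 * (‖g‖ + 1)) ≤ ε := (le_div_iff₀ (by positivity)).1 (min_le_right _ _)
    nlinarith
  have hev := hstrict.isLittleO.def hη0
  rw [nhds_prod_eq] at hev
  obtain ⟨pa, hpa, hpa'⟩ := (Filter.eventually_prod_self_iff
    (r := fun a b => ‖φ a - φ b - L (a - b)‖ ≤ η * ‖a - b‖ ∧ a ∈ U ∧ b ∈ U)).1
    (hev.and ((hU.eventually_mem hxU).prod_mk (hU.eventually_mem hxU)))
  obtain ⟨r₁, hr₁, hball⟩ := Metric.mem_nhds_iff.1 hpa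
  have hstr : ∀ a ∈ Metric.ball x r₁, ∀ b ∈ Metric.ball x r₁,
      |φ a - φ b - L (a - b)| ≤ η * ‖a - b‖ := fun a ha b hb =>
    (hpa' a (hball ha) b (hball hb)).1
  have hsub : Metric.ball x r₁ ⊆ U := fun a ha => (hpa' a (hball ha) a (hball ha)).2.1
  -- The flat point stays within r₁/4 of `x` and the shift is at most 2h ≤ r₁/2, so everything
  -- happens inside the ball of radius r₁.
  refine ⟨r₁ / 4, by positivity, fun v hv h hh hdist b hb hb1 => ?_⟩
  have hh0 : 0 ≤ h := (norm_nonneg _).trans (hdist 0 0)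
  have hvr : ∀ i, v i ∈ Metric.ball x r₁ := fun i =>
    Metric.ball_subset_ball (by linarith) (hv i).2
  have hv0 : ∀ i, φ (v i) = 0 := fun i => by
    have : v i ∈ Γ ∩ U := ⟨(hv i).1, hsub (hvr i)⟩
    rw [hΓU] at this
    exact this.2
  set y := ∑ i, b i • v i with hy
  have hyx : ‖y - x‖ ≤ r₁ / 4 := norm_sum_smul_sub_le hb hb1 v x fun i => by
    simpa [dist_eq_norm] using (Metric.mem_ball.1 (hv i).2).le
  have hy0 : ‖y - v 0‖ ≤ h := norm_sum_smul_sub_le hb hb1 v (v 0) fun i => hdist i 0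
  have hyr : y ∈ Metric.ball x r₁ := by
    rw [Metric.mem_ball, dist_eq_norm]; linarith
  have hLy : |L (y - v 0)| ≤ η * h := by
    have h1 : L (y - v 0) = ∑ i, b i * L (v i - v 0) := by
      have : y - v 0 = ∑ i, b i • (v i - v 0) := by
        simp only [smul_sub, Finset.sum_sub_distrib, ← Finset.sum_smul, hb1, one_smul, hy]
      rw [this, map_sum]
      simp
    rw [h1]
    calc _ ≤ ∑ i, b i * (η * h) := by
          refine (Finset.abs_sum_le_sum_abs _ _).trans (Finset.sum_le_sum fun i _ => ?_)
          rw [abs_mul, abs_of_nonneg (hb i)]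
          refine mul_le_mul_of_nonneg_left ?_ (hb i)
          have := hstr _ (hvr i) _ (hvr 0)
          rw [hv0, hv0, sub_zero, zero_sub, abs_neg] at this
          exact this.trans (mul_le_mul_of_nonneg_left (hdist i 0) hη0.le)
      _ = η * h := by rw [← Finset.sum_mul, hb1, one_mul]
  have hφy : |φ y| ≤ 2 * (η * h) := by
    have h1 := hstr _ hyr _ (hvr 0)
    rw [hv0, sub_zero] at h1
    have h2 : η * ‖y - v 0‖ ≤ η * h := mul_le_mul_of_nonneg_left hy0 hη0.le
    calc |φ y| = |(φ y - L (y - v 0)) + L (y - v 0)| := by ring_nf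
      _ ≤ _ := (abs_add_le _ _).trans (by linarith)
  have hmem : ∀ s : ℝ, |s| ≤ 4 * η * h → y + s • g ∈ Metric.ball x r₁ := fun s hs => by
    have h1 : ‖s • g‖ ≤ 2 * h := by
      rw [norm_smul, Real.norm_eq_abs]
      calc |s| * ‖g‖ ≤ (4 * η * h) * ‖g‖ := by gcongr
        _ = 4 * (η * ‖g‖) * h := by ring
        _ ≤ 4 * (1 / 2) * h := by gcongr
        _ = 2 * h := by ring
    rw [Metric.mem_ball, dist_eq_norm, add_sub_right_comm]
    calc _ ≤ ‖y - x‖ + ‖s • g‖ := norm_add_le _ _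
      _ < r₁ := by linarith
  have hs0 : 0 ≤ 4 * η * h := by positivity
  have hline : ∀ s : ℝ, |s| ≤ 4 * η * h → |φ (y + s • g) - φ y - s| ≤ |s| / 2 := fun s hs => by
    have h1 := hstr _ (hmem s hs) _ hyr
    rw [add_sub_cancel_left, map_smul, hg, smul_eq_mul, mul_one, norm_smul,
      Real.norm_eq_abs] at h1
    refine h1.trans ?_
    have := mul_le_mul_of_nonneg_left hη1 (abs_nonneg s)
    linarith
  have hcont : ContinuousOn (fun s : ℝ => φ (y + s • g)) (Set.Icc (-(4 * η * h)) (4 * η * h)) := by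
    refine hφ.continuousOn.comp (by fun_prop) fun s hs => hsub (hmem s (abs_le.2 hs))
  have hpos : 0 ≤ φ (y + (4 * η * h) • g) := by
    have h1 := (abs_le.1 (hline _ (abs_of_nonneg hs0).le)).1
    rw [abs_of_nonneg hs0] at h1
    have := (abs_le.1 hφy).1
    linarith
  have hneg : φ (y + (-(4 * η * h)) • g) ≤ 0 := by
    have h1 := (abs_le.1 (hline (-(4 * η * h)) (by rw [abs_neg, abs_of_nonneg hs0]))).2
    rw [abs_neg, abs_of_nonneg hs0] at h1
    have := (abs_le.1 hφy).2
    linarith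
  obtain ⟨s, hs, hs'⟩ := intermediate_value_Icc (by linarith) hcont ⟨hneg, hpos⟩
  have hsa : |s| ≤ 4 * η * h := abs_le.2 hs
  have hmemΓ : y + s • g ∈ Γ := by
    have : y + s • g ∈ Γ ∩ U := by
      rw [hΓU]
      exact ⟨hsub (hmem s hsa), hs'⟩
    exact this.1
  refine (Metric.infDist_le_dist_of_mem hmemΓ).trans ?_
  rw [dist_eq_norm, sub_add_cancel_left, norm_neg, norm_smul, Real.norm_eq_abs]
  calc |s| * ‖g‖ ≤ (4 * η * h) * ‖g‖ := by gcongr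
    _ = (4 * η * ‖g‖) * h := by ring
    _ ≤ ε * h := by gcongr

/-- A family of `C¹` fields with jointly continuous derivative is strictly differentiable at `x`,
uniformly in the parameter. -/
theorem exists_ball_norm_sub_sub_fderiv_le {I : Set ℝ} (hI : IsCompact I) {U : Set E3}
    (hU : IsOpen U) {W : ℝ → E3 → E3} (hW : ∀ t ∈ I, DifferentiableOn ℝ (W t) U)
    (hc : ContinuousOn (fun a : ℝ × E3 => fderiv ℝ (W a.1) a.2) (I ×ˢ U)) {x : E3} (hx : x ∈ U)
    {η : ℝ} (hη : 0 < η) :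
    ∃ r > 0, ∀ t ∈ I, ∀ a ∈ Metric.ball x r, ∀ b ∈ Metric.ball x r,
      ‖W t a - W t b - fderiv ℝ (W t) x (a - b)‖ ≤ η * ‖a - b‖ := by
  obtain ⟨r₀, hr₀, hsub⟩ := Metric.nhds_basis_closedBall.mem_iff.1 (hU.mem_nhds hx)
  have huc := (hI.prod (isCompact_closedBall x r₀)).uniformContinuousOn_of_continuous
    (hc.mono (Set.prod_mono le_rfl hsub))
  rw [Metric.uniformContinuousOn_iff] at huc
  obtain ⟨δ, hδ, H⟩ := huc η hη
  refine ⟨min δ r₀, by positivity, fun t ht a ha b hb => ?_⟩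
  have hball : Metric.ball x (min δ r₀) ⊆ Metric.closedBall x r₀ :=
    (Metric.ball_subset_ball (min_le_right _ _)).trans Metric.ball_subset_closedBall
  refine (convex_ball x (min δ r₀)).norm_image_sub_le_of_norm_fderiv_le' (fun z hz => ?_)
    (fun z hz => ?_) hb ha
  · exact (hW t ht).differentiableAt (hU.mem_nhds (hsub (hball hz)))
  · have := H (t, z) ⟨ht, hball hz⟩ (t, x) ⟨ht, Metric.mem_closedBall_self hr₀.le⟩ (by
      rw [Prod.dist_eq]
      simpa using (Metric.mem_ball.1 hz).trans_le (min_le_left _ _))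
    rw [dist_eq_norm] at this
    exact this.le

theorem IsC1Ck.exists_extension {T : ℝ} {k : ℕ} (hk : 1 ≤ k) {Γ : Set E3} {V : ℝ → E3 → E3}
    (hV : IsC1Ck T k Γ V) : ∃ U : Set E3, IsOpen U ∧ Γ ⊆ U ∧ ∃ W : ℝ → E3 → E3,
      (∀ t ∈ Set.Icc 0 T, ∀ z ∈ Γ, W t z = V t z) ∧
      (∀ t ∈ Set.Icc 0 T, DifferentiableOn ℝ (W t) U) ∧
      ContinuousOn (fun a : ℝ × E3 => fderiv ℝ (W a.1) a.2) (Set.Icc 0 T ×ˢ U) := by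
  obtain ⟨U, hU, hΓU, W₀, W₁, h1, h2, -, -, h5, -⟩ := hV
  refine ⟨U, hU, hΓU, W₀, h1, fun t ht => (h2 t ht).differentiableOn (by simp; omega), ?_⟩
  -- The first iterated derivative is the Fréchet derivative up to this currying isometry.
  have h := (continuousMultilinearCurryFin1 ℝ E3 E3).continuous.comp_continuousOn (h5 1 hk)
  refine h.congr fun a _ => ?_
  ext m : 1
  simp

/-! ### First-order control of the moving nodes. -/

namespace EvolvingSurface

/-- The velocity of the material point that starts at `z`. -/
noncomputable def pathVelocity (S : EvolvingSurface) (t : ℝ) (z : E3) : E3 :=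
  S.velocity t (S.flow t z)

theorem hasDerivWithinAt_flow (S : EvolvingSurface) {t : ℝ} (ht : t ∈ Set.Icc 0 S.T) {z : E3}
    (hz : z ∈ S.Γ₀) :
    HasDerivWithinAt (fun s => S.flow s z) (S.pathVelocity t z) (Set.Icc 0 S.T) t :=
  S.flow_ode t ht z hz

/-- At small scale the nodes and their velocities are nearly affine in the vertices. -/
theorem exists_near_affine (S : EvolvingSurface) : ∃ K > 0, ∀ ε > 0, ∃ δ > 0,
    ∀ v : Fin 3 → E3, (∀ i, v i ∈ S.Γ₀) → ∀ h ≤ δ, (∀ i j, ‖v i - v j‖ ≤ h) →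
      (∀ t ∈ Set.Icc 0 S.T, ∀ i j, ‖S.pathVelocity t (v i) - S.pathVelocity t (v j)‖ ≤ K * h) ∧
      ∀ b : Fin 3 → ℝ, (∀ i, 0 ≤ b i) → ∑ i, b i = 1 →
      ∀ p, IsClosestPoint S.Γ₀ (∑ i, b i • v i) p →
        ‖p - ∑ i, b i • v i‖ ≤ ε * h ∧ ∀ t ∈ Set.Icc 0 S.T,
          ‖S.pathVelocity t p - ∑ i, b i • S.pathVelocity t (v i)‖ ≤ ε * h := by
  have hk := S.three_le_k
  obtain ⟨U, hU, hΓU, W, hWV, hWd, hWc⟩ := S.velocity_regular.exists_extension (by omega)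
  obtain ⟨K₀, hK₀⟩ := (isCompact_Icc.prod S.compact).exists_bound_of_continuousOn
    (hWc.mono (Set.prod_mono (le_refl (Set.Icc 0 S.T)) hΓU))
  have hK : ∀ t ∈ Set.Icc 0 S.T, ∀ z ∈ S.Γ₀, ‖fderiv ℝ (W t) z‖ ≤ |K₀| := fun t ht z hz =>
    (hK₀ (t, z) ⟨ht, hz⟩).trans (le_abs_self _)
  refine ⟨|K₀| + 1, by positivity, fun ε hε => ?_⟩
  set ε₁ := min 1 (ε / (2 * (|K₀| + 1))) with hε₁
  have hε₁0 : 0 < ε₁ := by positivity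
  have hε₁1 : |K₀| * ε₁ ≤ ε / 2 := by
    have h1 : ε₁ * (2 * (|K₀| + 1)) ≤ ε := (le_div_iff₀ (by positivity)).1 (min_le_right _ _)
    nlinarith
  have hε₁2 : ε₁ ≤ ε := by
    have h1 : ε₁ * (2 * (|K₀| + 1)) ≤ ε := (le_div_iff₀ (by positivity)).1 (min_le_right _ _)
    nlinarith [mul_nonneg (abs_nonneg K₀) hε₁0.le]
  set η := min 1 (ε / 4) with hη
  have hη0 : 0 < η := by positivity
  have hη1 : η ≤ 1 := min_le_left _ _
  have hη2 : η ≤ ε / 4 := min_le_right _ _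
  have hloc : ∀ x : S.Γ₀, ∃ r > 0, (∀ v : Fin 3 → E3,
      (∀ i, v i ∈ S.Γ₀ ∧ v i ∈ Metric.ball x.1 r) → ∀ h,
      (∀ i j, ‖v i - v j‖ ≤ h) → ∀ b : Fin 3 → ℝ, (∀ i, 0 ≤ b i) → ∑ i, b i = 1 →
        Metric.infDist (∑ i, b i • v i) S.Γ₀ ≤ ε₁ * h) ∧
      ∀ t ∈ Set.Icc 0 S.T, ∀ a ∈ Metric.ball x.1 r, ∀ b ∈ Metric.ball x.1 r,
        ‖W t a - W t b - fderiv ℝ (W t) x (a - b)‖ ≤ η * ‖a - b‖ := fun x => by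
    obtain ⟨r₁, hr₁, H₁⟩ := S.hypersurface.exists_infDist_le (by omega) x.2 hε₁0
    obtain ⟨r₂, hr₂, H₂⟩ := exists_ball_norm_sub_sub_fderiv_le isCompact_Icc hU hWd hWc
      (hΓU x.2) hη0
    refine ⟨min r₁ r₂, by positivity, fun v hv => H₁ v (fun i => ⟨(hv i).1,
      Metric.ball_subset_ball (min_le_left _ _) (hv i).2⟩),
      fun t ht a ha b hb => H₂ t ht a (Metric.ball_subset_ball (min_le_right _ _) ha) b
        (Metric.ball_subset_ball (min_le_right _ _) hb)⟩
  choose r hr H₁ H₂ using hloc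
  -- A Lebesgue number makes the local radii uniform. Taking h ≤ δ/4 leaves room for the projected
  -- point, which lies within 2h of each vertex.
  obtain ⟨δ, hδ, hleb⟩ := lebesgue_number_lemma_of_metric S.compact
    (c := fun x : S.Γ₀ => Metric.ball x.1 (r x)) (fun x => Metric.isOpen_ball)
    fun z hz => Set.mem_iUnion.2 ⟨⟨z, hz⟩, Metric.mem_ball_self (hr _)⟩
  refine ⟨δ / 4, by positivity, fun v hv h hh hdist => ?_⟩
  have hh0 : 0 ≤ h := (norm_nonneg _).trans (hdist 0 0)
  obtain ⟨x, hx⟩ := hleb (v 0) (hv 0)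
  have hvx : ∀ i, v i ∈ Metric.ball x.1 (r x) := fun i => hx (by
    rw [Metric.mem_ball, dist_eq_norm]
    linarith [hdist i 0])
  have hLW : ∀ t ∈ Set.Icc 0 S.T, ∀ z ∈ S.Γ₀, S.pathVelocity t z = W t z := fun t ht z hz =>
    (hWV t ht z hz).symm
  constructor
  · intro t ht i j
    rw [hLW t ht _ (hv i), hLW t ht _ (hv j)]
    have h1 := H₂ x t ht _ (hvx i) _ (hvx j)
    have h2 := (fderiv ℝ (W t) x).le_of_opNorm_le (hK t ht x x.2) (v i - v j)
    calc _ = ‖(W t (v i) - W t (v j) - fderiv ℝ (W t) x (v i - v j)) +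
          fderiv ℝ (W t) x (v i - v j)‖ := by rw [sub_add_cancel]
      _ ≤ η * ‖v i - v j‖ + |K₀| * ‖v i - v j‖ := (norm_add_le _ _).trans (add_le_add h1 h2)
      _ ≤ 1 * h + |K₀| * h := by gcongr <;> exact hdist i j
      _ = _ := by ring
  intro b hb hb1 p hp
  set y := ∑ i, b i • v i with hy
  have hpy : ‖p - y‖ ≤ ε₁ * h := by
    rw [← dist_eq_norm, dist_comm, hp.2]
    exact H₁ x v (fun i => ⟨hv i, hvx i⟩) h hdist b hb hb1
  refine ⟨hpy.trans (by gcongr), fun t ht => ?_⟩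
  have hpv : ∀ i, ‖p - v i‖ ≤ 2 * h := fun i => by
    have hyv : ‖y - v i‖ ≤ h := norm_sum_smul_sub_le hb hb1 v (v i) fun j => hdist j i
    calc ‖p - v i‖ = ‖(p - y) + (y - v i)‖ := by rw [sub_add_sub_cancel]
      _ ≤ ε₁ * h + h := (norm_add_le _ _).trans (add_le_add hpy hyv)
      _ ≤ 1 * h + h := by gcongr; exact min_le_left _ _
      _ = 2 * h := by ring
  have hpx : p ∈ Metric.ball x.1 (r x) := hx (by
    rw [Metric.mem_ball, dist_eq_norm]
    linarith [hpv 0])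
  simp only [hLW t ht _ (hv _), hLW t ht _ hp.1]
  set L := fderiv ℝ (W t) x
  have hsum : ∀ (F : E3 → E3), F p - ∑ i, b i • F (v i) = ∑ i, b i • (F p - F (v i)) :=
    fun F => by
      simp only [smul_sub, Finset.sum_sub_distrib, ← Finset.sum_smul, hb1, one_smul]
  -- Because `L` is linear, the weighted sum of L(p - v_i) is L(p - y), which is small since p is
  -- close to the flat point y; the rest is the strict-differentiability error.
  have hsplit : W t p - ∑ i, b i • W t (v i) =
      L (p - y) + ∑ i, b i • (W t p - W t (v i) - L (p - v i)) := by
    have h1 : p - y = ∑ i, b i • (p - v i) := hsum id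
    rw [hsum, h1, map_sum, ← Finset.sum_add_distrib]
    refine Finset.sum_congr rfl fun i _ => ?_
    rw [map_smul, ← smul_add, add_sub_cancel]
  rw [hsplit]
  have h1 : ‖L (p - y)‖ ≤ |K₀| * (ε₁ * h) :=
    (L.le_of_opNorm_le (hK t ht x x.2) _).trans (by gcongr)
  have h2 : ‖∑ i, b i • (W t p - W t (v i) - L (p - v i))‖ ≤ η * (2 * h) := by
    have := norm_sum_smul_sub_le hb hb1 (fun i => W t p - W t (v i) - L (p - v i)) 0
      (h := η * (2 * h)) fun i => by
        rw [sub_zero]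
        exact (H₂ x t ht _ hpx _ (hvx i)).trans (by gcongr; exact hpv i)
    simpa using this
  calc _ ≤ |K₀| * (ε₁ * h) + η * (2 * h) := (norm_add_le _ _).trans (add_le_add h1 h2)
    _ ≤ |K₀| * (ε₁ * h) + ε / 4 * (2 * h) := by gcongr
    _ = (|K₀| * ε₁) * h + ε / 2 * h := by ring
    _ ≤ ε / 2 * h + ε / 2 * h := by gcongr
    _ = ε * h := by ring

/-- The flow preserves the smallness of the deviation from an affine map. -/
theorem norm_flow_sub_le (S : EvolvingSurface) {v : Fin 3 → E3} (hv : ∀ i, v i ∈ S.Γ₀) {p : E3}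
    (hp : p ∈ S.Γ₀) (b : Fin 3 → ℝ) {d : ℝ} (h0 : ‖p - ∑ i, b i • v i‖ ≤ d)
    (h1 : ∀ t ∈ Set.Icc 0 S.T,
      ‖S.pathVelocity t p - ∑ i, b i • S.pathVelocity t (v i)‖ ≤ d) :
    ∀ t ∈ Set.Icc 0 S.T, ‖S.flow t p - ∑ i, b i • S.flow t (v i)‖ ≤ (1 + S.T) * d := by
  intro t ht
  have hd : 0 ≤ d := (norm_nonneg _).trans h0
  -- The deviation has time derivative equal to the velocity deviation, so it grows from d by at
  -- most T · d.
  have h := norm_image_sub_le_of_norm_deriv_le_segment'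
    (f := fun t => S.flow t p - ∑ i, b i • S.flow t (v i))
    (f' := fun t => S.pathVelocity t p - ∑ i, b i • S.pathVelocity t (v i))
    (fun s hs => (S.hasDerivWithinAt_flow hs hp).sub (HasDerivWithinAt.fun_sum fun i _ =>
      (S.hasDerivWithinAt_flow hs (hv i)).const_smul (b i)))
    (fun s hs => h1 s (Set.Ico_subset_Icc_self hs)) t ht
  simp only [S.flow_zero _ hp, S.flow_zero _ (hv _)] at h
  have h2 : d * (t - 0) ≤ d * S.T := by
    rw [sub_zero]
    exact mul_le_mul_of_nonneg_left ht.2 hd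
  have h3 := norm_le_norm_add_norm_sub' (S.flow t p - ∑ i, b i • S.flow t (v i))
    (p - ∑ i, b i • v i)
  linarith

theorem continuousOn_flow (S : EvolvingSurface) {z : E3} (hz : z ∈ S.Γ₀) :
    ContinuousOn (fun t => S.flow t z) (Set.Icc 0 S.T) := fun _ ht =>
  (S.hasDerivWithinAt_flow ht hz).continuousWithinAt

end EvolvingSurface

/-! ### Area elements and the surface divergence -/

theorem convex_refTriangle : Convex ℝ refTriangle := by
  rintro x ⟨hx0, hx1, hx2⟩ y ⟨hy0, hy1, hy2⟩ a b ha hb hab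
  refine ⟨?_, ?_, ?_⟩
  · simp; positivity
  · simp; positivity
  · simp
    nlinarith [mul_le_mul_of_nonneg_left hx2 ha, mul_le_mul_of_nonneg_left hy2 hb]

theorem affineInterp_corner (w : Fin 3 → E3) (i : Fin 3) : affineInterp w (corner i) = w i := by
  simp [affineInterp, bary_corner]

theorem convexHull_range_subset_image (w : Fin 3 → E3) :
    convexHull ℝ (Set.range w) ⊆ affineInterp w '' refTriangle := by
  refine convexHull_min ?_ ?_
  · rintro _ ⟨i, rfl⟩
    exact ⟨corner i, corner_mem i, affineInterp_corner w i⟩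
  · rintro _ ⟨x, hx, rfl⟩ _ ⟨y, hy, rfl⟩ a b ha hb hab
    refine ⟨a • x + b • y, convex_refTriangle hx hy ha hb hab, ?_⟩
    have hb' : b = 1 - a := by linarith
    subst hb'
    ext i
    simp [affineInterp, bary, Fin.sum_univ_three]
    ring

theorem norm_sub_le_of_mem_refTriangle {x y : E2} (hx : x ∈ refTriangle) (hy : y ∈ refTriangle) :
    ‖y - x‖ ≤ 2 := by
  obtain ⟨hx0, hx1, hx2⟩ := hx
  obtain ⟨hy0, hy1, hy2⟩ := hy
  rw [EuclideanSpace.norm_eq, Real.sqrt_le_left (by norm_num)]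
  simp [Fin.sum_univ_two]
  nlinarith

theorem AffineIndependent.fderiv_affineInterp_injective {w : Fin 3 → E3}
    (hw : AffineIndependent ℝ w) (ξ : E2) (h : ξ 0 • (w 1 - w 0) + ξ 1 • (w 2 - w 0) = 0) :
    ξ = 0 := by
  have h1 := affineIndependent_iff.1 hw Finset.univ ![-(ξ 0 + ξ 1), ξ 0, ξ 1]
    (by simp [Fin.sum_univ_three])
    (by
      rw [← h]
      ext i
      simp [Fin.sum_univ_three]
      ring)
  ext i
  fin_cases i
  · simpa using h1 1 (Finset.mem_univ _)
  · simpa using h1 2 (Finset.mem_univ _)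

/-- A triangle that contains a disc of radius `R` is not thin. -/
theorem mul_norm_le_norm_fderiv_affineInterp {w : Fin 3 → E3} (hw : AffineIndependent ℝ w)
    {R : ℝ} (hR : 0 ≤ R) {z : E3} (hz : z ∈ affineSpan ℝ (Set.range w))
    (hdisc : Metric.closedBall z R ∩ affineSpan ℝ (Set.range w) ⊆ convexHull ℝ (Set.range w))
    (x ξ : E2) : R * ‖ξ‖ ≤ 2 * ‖fderiv ℝ (affineInterp w) x ξ‖ := by
  rcases eq_or_ne ξ 0 with rfl | hξ
  · simp
  rw [fderiv_affineInterp]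
  set D := ξ 0 • (w 1 - w 0) + ξ 1 • (w 2 - w 0) with hD
  have hD0 : D ≠ 0 := fun h => hξ (hw.fderiv_affineInterp_injective ξ h)
  have hm : 0 < ‖D‖ := norm_pos_iff.2 hD0
  have hdir : D ∈ (affineSpan ℝ (Set.range w)).direction := by
    have hs : ∀ i, w i -ᵥ w 0 ∈ (affineSpan ℝ (Set.range w)).direction := fun i =>
      AffineSubspace.vsub_mem_direction (mem_affineSpan ℝ ⟨i, rfl⟩) (mem_affineSpan ℝ ⟨0, rfl⟩)
    exact add_mem (Submodule.smul_mem _ _ (hs 1)) (Submodule.smul_mem _ _ (hs 2))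
  -- The centre of the disc and its boundary point in direction D both lie in the triangle. Their
  -- reference coordinates differ by (R/‖D‖)ξ, which must fit into a reference triangle of diameter
  -- at most 2.
  obtain ⟨y, hy, hyz⟩ := convexHull_range_subset_image w
    (hdisc ⟨Metric.mem_closedBall_self hR, hz⟩)
  obtain ⟨y', hy', hyz'⟩ := convexHull_range_subset_image w
    (hdisc (a := (R / ‖D‖) • D +ᵥ z) ⟨by
      rw [Metric.mem_closedBall, dist_eq_norm, vadd_eq_add, add_sub_cancel_right, norm_smul,
        Real.norm_of_nonneg (by positivity), div_mul_cancel₀ _ hm.ne'],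
      AffineSubspace.vadd_mem_of_mem_direction (Submodule.smul_mem _ _ hdir) hz⟩)
  have hdiff : y' - y - (R / ‖D‖) • ξ = 0 := by
    refine hw.fderiv_affineInterp_injective _ ?_
    have h1 := affineInterp_sub w y y'
    rw [hyz, hyz', vadd_eq_add, add_sub_cancel_right] at h1
    calc _ = ((y' - y) 0 • (w 1 - w 0) + (y' - y) 1 • (w 2 - w 0)) - (R / ‖D‖) • D := by
          rw [hD]
          ext i
          simp
          ring
      _ = 0 := by rw [← h1, sub_self]
  have h2 := norm_sub_le_of_mem_refTriangle hy hy'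
  rw [sub_eq_zero.1 hdiff, norm_smul, Real.norm_of_nonneg (by positivity), div_mul_eq_mul_div,
    div_le_iff₀ hm] at h2
  exact h2

/-! ### Gram determinant, surface divergence and transport of area. -/

theorem jacobian_mulVec (X : E2 → E3) (x : E2) (ξ : Fin 2 → ℝ) :
    jacobian X x *ᵥ ξ = (fderiv ℝ X x (WithLp.toLp 2 ξ)).ofLp := by
  have h : (WithLp.toLp 2 ξ : E2) =
      ξ 0 • EuclideanSpace.single 0 1 + ξ 1 • EuclideanSpace.single 1 1 := by
    ext i; fin_cases i <;> simp
  rw [h]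
  ext i
  simp [mulVec, dotProduct, jacobian, Fin.sum_univ_two]
  ring

theorem gram_det_eq (X : E2 → E3) (x : E2) : (gram X x).det =
    (∑ i, jacobian X x i 0 * jacobian X x i 0) * (∑ i, jacobian X x i 1 * jacobian X x i 1) -
      (∑ i, jacobian X x i 0 * jacobian X x i 1) * (∑ i, jacobian X x i 0 * jacobian X x i 1) := by
  simp only [_root_.gram, det_fin_two, mul_apply, transpose_apply]
  simp only [Fin.sum_univ_three]
  ring

/-- Lagrange's identity; it turns the orientation condition on the mesh into nondegeneracy of the
parametrization. -/
theorem gram_det_eq_norm_sq (X : E2 → E3) (x : E2) :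
    (gram X x).det = ‖crossNormal X x‖ ^ 2 := by
  rw [gram_det_eq, EuclideanSpace.norm_sq_eq]
  simp [crossNormal, cross_apply, Fin.sum_univ_three]
  ring

theorem gram_det_pos {X : E2 → E3} {x : E2} (h : crossNormal X x ≠ 0) : 0 < (gram X x).det := by
  rw [gram_det_eq_norm_sq]
  have := norm_pos_iff.2 h
  positivity

/-- Clearing the determinant replaces the inverse Gram matrix by its adjugate and leaves a
polynomial in Jacobian entries, which can be matched with the derivative of the determinant. -/
theorem det_mul_surfDiv {X : E2 → E3} {x : E2} (h : (gram X x).det ≠ 0) (V : E2 → E3) :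
    (gram X x).det * surfDiv X V x =
      (∑ i, jacobian V x i 0 * jacobian X x i 0) * (∑ i, jacobian X x i 1 * jacobian X x i 1) +
      (∑ i, jacobian V x i 1 * jacobian X x i 1) * (∑ i, jacobian X x i 0 * jacobian X x i 0) -
      (∑ i, (jacobian V x i 0 * jacobian X x i 1 + jacobian V x i 1 * jacobian X x i 0)) *
        (∑ i, jacobian X x i 0 * jacobian X x i 1) := by
  have h1 : (gram X x).det * surfDiv X V x =
      (jacobian V x * ((gram X x).adjugate * (jacobian X x)ᵀ)).trace := by
    rw [surfDiv, surfGrad, pinv, inv_def, Ring.inverse_eq_inv', Matrix.smul_mul, Matrix.mul_smul, trace_smul,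
      smul_eq_mul, mul_inv_cancel_left₀ h]
  rw [h1, adjugate_fin_two]
  simp only [_root_.gram, trace_fin_three, mul_apply, transpose_apply, Fin.sum_univ_two,
    Fin.sum_univ_three, of_apply, cons_val_zero, cons_val_one, cons_val', cons_val_fin_one]
  ring

theorem hasDerivWithinAt_gram_det {X : ℝ → E2 → E3} {V : E2 → E3} {x : E2} {I : Set ℝ} {t : ℝ}
    (h : ∀ i a, HasDerivWithinAt (fun s => jacobian (X s) x i a) (jacobian V x i a) I t)
    (hdet : (gram (X t) x).det ≠ 0) :
    HasDerivWithinAt (fun s => (gram (X s) x).det)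
      (2 * ((gram (X t) x).det * surfDiv (X t) V x)) I t := by
  simp only [gram_det_eq _ x]
  rw [← gram_det_eq, det_mul_surfDiv hdet]
  have hs : ∀ a b : Fin 2, HasDerivWithinAt
      (fun s => ∑ i, jacobian (X s) x i a * jacobian (X s) x i b)
      (∑ i, (jacobian V x i a * jacobian (X t) x i b + jacobian (X t) x i a * jacobian V x i b))
      I t := fun a b => HasDerivWithinAt.fun_sum fun i _ => (h i a).mul (h i b)
  refine (((hs 0 0).mul (hs 1 1)).sub ((hs 0 1).mul (hs 0 1))).congr_deriv ?_
  simp only [Fin.sum_univ_three]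
  ring

theorem norm_sq_eq_dotProduct (v : E3) : ‖v‖ ^ 2 = v.ofLp ⬝ᵥ v.ofLp := by
  rw [EuclideanSpace.norm_sq_eq]
  simp [dotProduct, Fin.sum_univ_three]
  ring

/-- The Jacobian times `pinv` is the orthogonal projection onto the tangent plane, so its column w
in direction i satisfies ‖w‖² = w_i ≤ ‖w‖. -/
theorem norm_fderiv_pinv_le {X : E2 → E3} {x : E2} (h : (gram X x).det ≠ 0) (i : Fin 3) :
    ‖fderiv ℝ X x (WithLp.toLp 2 fun a => pinv X x a i)‖ ≤ 1 := by
  set J := jacobian X x with hJ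
  set ξ : Fin 2 → ℝ := fun a => pinv X x a i with hξ
  have hG : gram X x *ᵥ ξ = fun a => J i a := by
    have h1 : gram X x * pinv X x = Jᵀ := by
      rw [pinv, ← Matrix.mul_assoc, mul_nonsing_inv _ (isUnit_iff_ne_zero.2 h), Matrix.one_mul]
    ext a
    exact congrFun (congrFun h1 a) i
  have h1 : (J *ᵥ ξ) ⬝ᵥ (J *ᵥ ξ) = (J *ᵥ ξ) i := by
    have h2 : (J *ᵥ ξ) ⬝ᵥ (J *ᵥ ξ) = ξ ⬝ᵥ (gram X x *ᵥ ξ) := by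
      rw [dotProduct_mulVec, ← mulVec_transpose, mulVec_mulVec, dotProduct_comm]
      rfl
    rw [h2, hG, dotProduct_comm]
    rfl
  rw [jacobian_mulVec, ← norm_sq_eq_dotProduct] at h1
  have h3 := PiLp.norm_apply_le (fderiv ℝ X x (WithLp.toLp 2 ξ)) i
  rw [Real.norm_eq_abs] at h3
  have h4 := (le_abs_self _).trans h3
  rw [← h1] at h4
  nlinarith [norm_nonneg (fderiv ℝ X x (WithLp.toLp 2 ξ))]

/-- The diagonal entries of DV · `pinv` are tested against columns that DX maps to vectors of norm
at most 1; the factor 3 counts these entries. -/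
theorem abs_surfDiv_le {X V : E2 → E3} {x : E2} (h : (gram X x).det ≠ 0) {C : ℝ}
    (hC : 0 ≤ C) (hV : ∀ ξ, ‖fderiv ℝ V x ξ‖ ≤ C * ‖fderiv ℝ X x ξ‖) :
    |surfDiv X V x| ≤ 3 * C := by
  have hentry : ∀ i, |surfGrad X V x i i| ≤ C := fun i => by
    have h1 : surfGrad X V x i i =
        (fderiv ℝ V x (WithLp.toLp 2 fun a => pinv X x a i)) i := by
      rw [← jacobian_mulVec]
      rfl
    rw [h1, ← Real.norm_eq_abs]
    refine (PiLp.norm_apply_le _ i).trans ((hV _).trans ?_)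
    exact mul_le_of_le_one_right hC (norm_fderiv_pinv_le h i)
  rw [surfDiv, trace_fin_three]
  refine (abs_add_three _ _ _).trans ?_
  linarith [hentry 0, hentry 1, hentry 2]

/-- Transport of the area element. -/
theorem areaElement_le_exp_mul {X V : ℝ → E2 → E3} {x : E2} {T C : ℝ}
    (h : ∀ t ∈ Set.Icc 0 T, ∀ i a,
      HasDerivWithinAt (fun s => jacobian (X s) x i a) (jacobian (V t) x i a) (Set.Icc 0 T) t)
    (hdet : ∀ t ∈ Set.Icc 0 T, 0 < (gram (X t) x).det)
    (hC : ∀ t ∈ Set.Icc 0 T, |surfDiv (X t) (V t) x| ≤ C) {s t : ℝ} (hs : s ∈ Set.Icc 0 T)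
    (ht : t ∈ Set.Icc 0 T) (hst : s ≤ t) :
    areaElement (X s) x ≤ Real.exp (C * (t - s)) * areaElement (X t) x := by
  -- The determinant is the square of the area element, hence the 2 in the exponent: F' is a
  -- nonnegative multiple of div V + C ≥ 0.
  set F : ℝ → ℝ := fun t => (gram (X t) x).det * Real.exp (2 * C * t) with hF
  have hexp : ∀ t, HasDerivAt (fun t : ℝ => Real.exp (2 * C * t))
      (Real.exp (2 * C * t) * (2 * C)) t := fun t => by
    have := ((hasDerivAt_id t).const_mul (2 * C)).exp
    simpa using this
  have hFd : ∀ t ∈ Set.Icc 0 T, HasDerivWithinAt F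
      (2 * ((gram (X t) x).det * (surfDiv (X t) (V t) x + C)) * Real.exp (2 * C * t))
      (Set.Icc 0 T) t := fun t ht => by
    refine ((hasDerivWithinAt_gram_det (h t ht) (hdet t ht).ne').mul
      (hexp t).hasDerivWithinAt).congr_deriv ?_
    ring
  have hmono : MonotoneOn F (Set.Icc 0 T) := by
    have hI : ∀ t ∈ interior (Set.Icc 0 T), HasDerivAt F
      (2 * ((gram (X t) x).det * (surfDiv (X t) (V t) x + C)) * Real.exp (2 * C * t)) t :=
      fun t ht => (hFd t (interior_subset ht)).hasDerivAt (mem_interior_iff_mem_nhds.1 ht)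
    refine monotoneOn_of_deriv_nonneg (convex_Icc 0 T)
      (fun t ht => (hFd t ht).continuousWithinAt)
      (fun t ht => (hI t ht).differentiableAt.differentiableWithinAt) fun t ht => ?_
    rw [(hI t ht).deriv]
    have h1 := hdet t (interior_subset ht)
    have h2 := (abs_le.1 (hC t (interior_subset ht))).1
    have h3 : 0 ≤ surfDiv (X t) (V t) x + C := by linarith
    positivity
  have h1 : (gram (X s) x).det ≤ (gram (X t) x).det * Real.exp (C * (t - s)) ^ 2 := by
    have h2 := hmono hs ht hst
    simp only [hF] at h2
    have h3 : Real.exp (2 * C * t) = Real.exp (C * (t - s)) ^ 2 * Real.exp (2 * C * s) := by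
      rw [← Real.exp_nat_mul, ← Real.exp_add]
      congr 1
      push_cast
      ring
    rw [h3, ← mul_assoc] at h2
    exact le_of_mul_le_mul_right h2 (Real.exp_pos _)
  rw [areaElement, areaElement]
  calc _ ≤ Real.sqrt ((gram (X t) x).det * Real.exp (C * (t - s)) ^ 2) := Real.sqrt_le_sqrt h1
    _ = _ := by rw [Real.sqrt_mul (hdet t ht).le, Real.sqrt_sq (Real.exp_pos _).le, mul_comm]

theorem hasDerivWithinAt_jacobian_lagrangeMap {k : ℕ} {a : ℝ → (Fin 3 → ℕ) → E3}
    {a' : (Fin 3 → ℕ) → E3} {I : Set ℝ} {t : ℝ}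
    (h : ∀ α ∈ Finset.Nat.antidiagonalTuple 3 k, HasDerivWithinAt (fun s => a s α) (a' α) I t)
    (x : E2) (i : Fin 3) (j : Fin 2) :
    HasDerivWithinAt (fun s => jacobian (lagrangeMap k (a s)) x i j)
      (jacobian (lagrangeMap k a') x i j) I t := by
  simp only [jacobian, of_apply, fderiv_lagrangeMap_apply]
  have h1 : HasDerivWithinAt (fun s => ∑ α ∈ Finset.Nat.antidiagonalTuple 3 k,
      (fderiv ℝ (fun y : E2 => lagrangeBasis k α (bary y)) x (EuclideanSpace.single j 1)) • a s α)
      (∑ α ∈ Finset.Nat.antidiagonalTuple 3 k,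
      (fderiv ℝ (fun y : E2 => lagrangeBasis k α (bary y)) x (EuclideanSpace.single j 1)) • a' α)
      I t := HasDerivWithinAt.fun_sum fun α hα => (h α hα).fun_const_smul _
  exact (EuclideanSpace.proj i : E3 →L[ℝ] ℝ).hasFDerivAt.comp_hasDerivWithinAt t h1

/-! ### Bounds that are uniform in the mesh -/

namespace Mesh

variable {kg : ℕ} {M : Mesh kg} {S : EvolvingSurface}

theorem IsAdmissible.node_mem (hM : M.IsAdmissible S) (τ : Fin M.nT) {α : Fin 3 → ℕ}
    (hα : α ∈ Finset.Nat.antidiagonalTuple 3 kg) : M.node τ α ∈ S.Γ₀ :=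
  (hM.node_closest τ α hα).1

/-- A vertex lies on Γ₀, so its distance to the surface is zero and its closest point is itself. -/
theorem IsAdmissible.node_corner (hM : M.IsAdmissible S) (hkg : 1 ≤ kg) (τ : Fin M.nT)
    (i : Fin 3) : M.node τ (Pi.single i kg) = M.pos (M.vert τ i) := by
  have h := hM.node_closest τ (Pi.single i kg)
    (by rw [Finset.Nat.mem_antidiagonalTuple]; simp)
  have hk : (kg : ℝ) ≠ 0 := by positivity
  have h1 : ∑ j, (((Pi.single i kg : Fin 3 → ℕ) j : ℝ) / kg) • M.pos (M.vert τ j) =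
      M.pos (M.vert τ i) := by
    rw [Finset.sum_eq_single i]
    · simp [hk]
    · intro j _ hj
      simp [hj]
    · simp
  rw [h1] at h
  have h2 := h.2
  rw [Metric.infDist_zero_of_mem (hM.pos_mem _)] at h2
  exact (dist_eq_zero.1 h2).symm

theorem elementMap_corner (hM : M.IsAdmissible S) (hkg : 1 ≤ kg) (τ : Fin M.nT) (t : ℝ)
    (i : Fin 3) : M.elementMap S τ t (corner i) = S.flow t (M.pos (M.vert τ i)) := by
  rw [elementMap, lagrangeMap_corner, hM.node_corner hkg]

theorem contDiff_elementMap (τ : Fin M.nT) (t : ℝ) : ContDiff ℝ ⊤ (M.elementMap S τ t) :=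
  contDiff_lagrangeMap _ _

theorem IsAdmissible.continuousOn_elementMap (hM : M.IsAdmissible S) (τ : Fin M.nT) :
    ContinuousOn (fun a : ℝ × E2 => M.elementMap S τ a.1 a.2) (Set.Icc 0 S.T ×ˢ refTriangle) := by
  unfold elementMap lagrangeMap
  refine continuousOn_finsetSum _ fun α hα => ContinuousOn.fun_smul ?_ ?_
  · exact ((contDiff_lagrangeBasis kg α).continuous.comp continuous_snd).continuousOn
  · exact (S.continuousOn_flow (hM.node_mem τ hα)).comp continuous_fst.continuousOn
      fun a ha => ha.1

/-- Without boundedness the real `sSup` in `meshSize` would default to 0 and bound no diameter.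
Compactness of [0,T] times the triangle excludes this. -/
theorem IsAdmissible.bddAbove_diam (hM : M.IsAdmissible S) :
    BddAbove {d | ∃ t ∈ Set.Icc 0 S.T, ∃ τ, d = Metric.diam (M.element S τ t)} := by
  have hK : ∀ τ, IsCompact ((fun a : ℝ × E2 => M.elementMap S τ a.1 a.2) ''
      (Set.Icc 0 S.T ×ˢ refTriangle)) := fun τ =>
    (isCompact_Icc.prod isCompact_refTriangle).image_of_continuousOn (hM.continuousOn_elementMap τ)
  refine ⟨∑ τ, Metric.diam ((fun a : ℝ × E2 => M.elementMap S τ a.1 a.2) ''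
      (Set.Icc 0 S.T ×ˢ refTriangle)), ?_⟩
  rintro _ ⟨t, ht, τ, rfl⟩
  refine (Metric.diam_mono ?_ (hK τ).isBounded).trans
    (Finset.single_le_sum (f := fun τ => Metric.diam ((fun a : ℝ × E2 =>
      M.elementMap S τ a.1 a.2) '' (Set.Icc 0 S.T ×ˢ refTriangle)))
      (fun _ _ => Metric.diam_nonneg) (Finset.mem_univ τ))
  rintro _ ⟨x, hx, rfl⟩
  exact ⟨(t, x), ⟨ht, hx⟩, rfl⟩

theorem IsAdmissible.norm_vertex_sub_le_meshSize (hM : M.IsAdmissible S) (hkg : 1 ≤ kg)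
    (τ : Fin M.nT) (i j : Fin 3) :
    ‖M.pos (M.vert τ i) - M.pos (M.vert τ j)‖ ≤ M.meshSize S := by
  have h0 : (0 : ℝ) ∈ Set.Icc 0 S.T := ⟨le_rfl, S.T_pos.le⟩
  have hmem : ∀ i, M.pos (M.vert τ i) ∈ M.element S τ 0 := fun i =>
    ⟨corner i, corner_mem i, by rw [elementMap_corner hM hkg, S.flow_zero _ (hM.pos_mem _)]⟩
  have hb : Bornology.IsBounded (M.element S τ 0) :=
    (isCompact_refTriangle.image (contDiff_elementMap τ 0).continuous).isBounded
  rw [← dist_eq_norm]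
  exact (Metric.dist_le_diam_of_mem hb (hmem i) (hmem j)).trans
    (le_csSup hM.bddAbove_diam ⟨0, h0, τ, rfl⟩)

/-- The orientation condition speaks only of existing closest points; `closest_unique` supplies one,
and strict positivity of the inner product excludes a zero normal. -/
theorem IsAdmissible.crossNormal_ne_zero (hM : M.IsAdmissible S) {t : ℝ}
    (ht : t ∈ Set.Icc 0 S.T) (τ : Fin M.nT) {x : E2} (hx : x ∈ refTriangle) :
    crossNormal (M.elementMap S τ t) x ≠ 0 := by
  obtain ⟨p, hp, -⟩ := hM.closest_unique t ht (M.elementMap S τ t x)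
    (Set.mem_iUnion.2 ⟨τ, x, hx, rfl⟩)
  intro h
  have := hM.oriented t ht τ x hx p hp
  rw [h, inner_zero_left] at this
  exact lt_irrefl _ this

theorem IsAdmissible.gram_det_pos (hM : M.IsAdmissible S) {t : ℝ}
    (ht : t ∈ Set.Icc 0 S.T) (τ : Fin M.nT) {x : E2} (hx : x ∈ refTriangle) :
    0 < (_root_.gram (M.elementMap S τ t) x).det :=
  _root_.gram_det_pos (hM.crossNormal_ne_zero ht τ hx)

/-- On fine quasi-uniform meshes the gradient of the discrete material velocity is bounded. -/
theorem exists_norm_fderiv_velocity_le (S : EvolvingSurface) {kg : ℕ} (hkg : 1 ≤ kg) {ρ : ℝ}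
    (hρ : 0 < ρ) : ∃ C > 0, ∃ h₀ > 0, ∀ M : Mesh kg, M.IsAdmissible S →
      M.IsUniformlyQuasiUniform S ρ → M.meshSize S ≤ h₀ → ∀ τ, ∀ t ∈ Set.Icc 0 S.T,
      ∀ x ∈ refTriangle, ∀ ξ, ‖fderiv ℝ (M.velocity S τ t) x ξ‖ ≤
        C * ‖fderiv ℝ (M.elementMap S τ t) x ξ‖ := by
  obtain ⟨K, hK, hnear⟩ := S.exists_near_affine
  obtain ⟨B, hB, hlag⟩ := exists_norm_fderiv_lagrangeMap_le kg
  have hT := S.T_pos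
  -- Chosen so that the interpolation error in DX is at most ρh/4, half of the lower bound ρh/2 for
  -- the flat triangle.
  set ε := ρ / (4 * (B * (1 + S.T))) with hε
  have hε0 : 0 < ε := by positivity
  have hBε : B * ((1 + S.T) * ε) = ρ / 4 := by
    rw [hε]; field_simp
  obtain ⟨δ, hδ, H⟩ := hnear ε hε0
  refine ⟨(B * ε + 2 * K) * (4 / ρ), by positivity, δ, hδ,
    fun M hM hQ hmesh τ t ht x hx ξ => ?_⟩
  set h := M.meshSize S with hh
  set v : Fin 3 → E3 := fun i => M.pos (M.vert τ i) with hv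
  have hvΓ : ∀ i, v i ∈ S.Γ₀ := fun i => hM.pos_mem _
  obtain ⟨hVK, hnode⟩ := H v hvΓ h hmesh fun i j => hM.norm_vertex_sub_le_meshSize hkg τ i j
  have hh0 : 0 ≤ h := (norm_nonneg _).trans (hM.norm_vertex_sub_le_meshSize hkg τ 0 0)
  have hweights : ∀ α ∈ Finset.Nat.antidiagonalTuple 3 kg, ∑ i, (α i : ℝ) / kg = 1 :=
    fun α hα => by
      rw [Finset.Nat.mem_antidiagonalTuple] at hα
      rw [← Finset.sum_div, ← Nat.cast_sum, hα, div_self (by positivity)]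
  have hX : ∀ α ∈ Finset.Nat.antidiagonalTuple 3 kg,
      ‖S.flow t (M.node τ α) - flatNode kg (fun i => S.flow t (v i)) α‖ ≤
        (1 + S.T) * (ε * h) := fun α hα => by
    obtain ⟨h1, h2⟩ := hnode (fun i => (α i : ℝ) / kg) (fun i => by positivity)
      (hweights α hα) _ (hM.node_closest τ α hα)
    exact S.norm_flow_sub_le hvΓ (hM.node_mem τ hα) _ h1 h2 t ht
  have hV : ∀ α ∈ Finset.Nat.antidiagonalTuple 3 kg,
      ‖S.pathVelocity t (M.node τ α) - flatNode kg (fun i => S.pathVelocity t (v i)) α‖ ≤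
        ε * h := fun α hα =>
    (hnode (fun i => (α i : ℝ) / kg) (fun i => by positivity)
      (hweights α hα) _ (hM.node_closest τ α hα)).2 t ht
  have hDX : ρ / 4 * h * ‖ξ‖ ≤ ‖fderiv ℝ (M.elementMap S τ t) x ξ‖ := by
    obtain ⟨hai, z, hz, hdisc⟩ := hQ t ht τ
    have h1 := mul_norm_le_norm_fderiv_affineInterp hai (by positivity) hz hdisc x ξ
    have h2 := hlag _ _ hX x hx ξ
    rw [← fderiv_lagrangeMap_sub_affine hkg] at h2
    have h3 := norm_le_norm_add_norm_sub
      (fderiv ℝ (lagrangeMap kg fun α => S.flow t (M.node τ α)) x ξ)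
      (fderiv ℝ (affineInterp fun i => S.flow t (v i)) x ξ)
    have h4 : B * ((1 + S.T) * (ε * h)) = ρ / 4 * h := by
      rw [← hBε]; ring
    rw [h4] at h2
    change _ ≤ ‖fderiv ℝ (lagrangeMap kg fun α => S.flow t (M.node τ α)) x ξ‖
    linarith
  have hDV : ‖fderiv ℝ (M.velocity S τ t) x ξ‖ ≤ (B * ε + 2 * K) * (h * ‖ξ‖) := by
    have h2 := hlag _ _ hV x hx ξ
    rw [← fderiv_lagrangeMap_sub_affine hkg] at h2
    -- Two edge differences, each of size at most Kh, give the factor 2K.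
    have h3 : ‖fderiv ℝ (affineInterp fun i => S.pathVelocity t (v i)) x ξ‖ ≤
        2 * K * (h * ‖ξ‖) := by
      rw [fderiv_affineInterp]
      refine (norm_add_le _ _).trans ?_
      rw [norm_smul, norm_smul]
      have h5 : ∀ (a : Fin 2) (i : Fin 3),
          ‖ξ a‖ * ‖S.pathVelocity t (v i) - S.pathVelocity t (v 0)‖ ≤ ‖ξ‖ * (K * h) :=
        fun a i => mul_le_mul (PiLp.norm_apply_le ξ a) (hVK t ht i 0) (norm_nonneg _)
          (norm_nonneg _)
      linarith [h5 0 1, h5 1 2]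
    have h4 := norm_le_norm_add_norm_sub'
      (fderiv ℝ (lagrangeMap kg fun α => S.pathVelocity t (M.node τ α)) x ξ)
      (fderiv ℝ (affineInterp fun i => S.pathVelocity t (v i)) x ξ)
    change ‖fderiv ℝ (lagrangeMap kg fun α => S.pathVelocity t (M.node τ α)) x ξ‖ ≤ _
    linarith
  calc _ ≤ (B * ε + 2 * K) * (h * ‖ξ‖) := hDV
    _ = (B * ε + 2 * K) * (4 / ρ) * (ρ / 4 * h * ‖ξ‖) := by
      field_simp
    _ ≤ _ := by gcongr

/-- The mesh-independent consequences for the discrete divergence and the area elements. -/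
theorem exists_surfDiv_areaElement_bound (S : EvolvingSurface) {kg : ℕ} (hkg : 1 ≤ kg) {ρ : ℝ}
    (hρ : 0 < ρ) : ∃ C > 0, ∃ h₀ > 0, ∀ M : Mesh kg, M.IsAdmissible S →
      M.IsUniformlyQuasiUniform S ρ → M.meshSize S ≤ h₀ → ∀ τ, ∀ x ∈ refTriangle,
      ∀ t ∈ Set.Icc 0 S.T, |surfDiv (M.elementMap S τ t) (M.velocity S τ t) x| ≤ C ∧
        ∀ s ∈ Set.Icc 0 S.T, s ≤ t → areaElement (M.elementMap S τ s) x ≤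
          Real.exp (C * (t - s)) * areaElement (M.elementMap S τ t) x := by
  obtain ⟨C, hC, h₀, hh₀, H⟩ := exists_norm_fderiv_velocity_le S hkg hρ
  refine ⟨3 * C, by positivity, h₀, hh₀, fun M hM hQ hmesh τ x hx t ht => ?_⟩
  have hdiv : ∀ t ∈ Set.Icc 0 S.T,
      |surfDiv (M.elementMap S τ t) (M.velocity S τ t) x| ≤ 3 * C := fun t ht =>
    abs_surfDiv_le (hM.gram_det_pos ht τ hx).ne' hC.le (H M hM hQ hmesh τ t ht x hx)
  refine ⟨hdiv t ht, fun s hs hst => areaElement_le_exp_mul (fun r hr i a => ?_)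
    (fun r hr => hM.gram_det_pos hr τ hx) hdiv hs ht hst⟩
  exact hasDerivWithinAt_jacobian_lagrangeMap
    (fun α hα => S.hasDerivWithinAt_flow hr (hM.node_mem τ hα)) x i a

end Mesh

/-! ### Energy estimates -/

theorem refInterior_subset : refInterior ⊆ refTriangle := fun _ hx =>
  ⟨hx.1.le, hx.2.1.le, hx.2.2.le⟩

theorem measurableSet_refInterior : MeasurableSet refInterior := by
  have : refInterior = {x : E2 | 0 < x 0} ∩ ({x : E2 | 0 < x 1} ∩ {x : E2 | x 0 + x 1 < 1}) := rfl
  rw [this]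
  exact ((isOpen_lt (by fun_prop) (by fun_prop)).inter
    ((isOpen_lt (by fun_prop) (by fun_prop)).inter
      (isOpen_lt (by fun_prop) (by fun_prop)))).measurableSet

/-- Monotonicity of the integral that needs no integrability of the smaller function. -/
theorem setIntegral_refInterior_le {g f : E2 → ℝ} (hf : IntegrableOn f refInterior)
    (hf0 : ∀ x ∈ refInterior, 0 ≤ f x) (h : ∀ x ∈ refInterior, g x ≤ f x) :
    ∫ x in refInterior, g x ≤ ∫ x in refInterior, f x := by
  by_cases hg : IntegrableOn g refInterior
  · exact setIntegral_mono_on hg hf measurableSet_refInterior h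
  -- The integral of a non-integrable function is 0 by convention, which lies below the integral of
  -- the nonnegative majorant.
  · rw [integral_undef hg]
    exact setIntegral_nonneg measurableSet_refInterior hf0

theorem areaElement_nonneg (X : E2 → E3) (x : E2) : 0 ≤ areaElement X x := Real.sqrt_nonneg _

namespace Mesh

variable {kg : ℕ} {M : Mesh kg} {S : EvolvingSurface}

theorem continuous_areaElement (τ : Fin M.nT) (t : ℝ) :
    Continuous (areaElement (M.elementMap S τ t)) := by
  have h : ∀ i a, Continuous fun x => jacobian (M.elementMap S τ t) x i a := fun i a =>
    (EuclideanSpace.proj i : E3 →L[ℝ] ℝ).continuous.comp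
      (((contDiff_elementMap τ t).continuous_fderiv (by simp)).clm_apply continuous_const)
  unfold areaElement
  simp only [gram_det_eq]
  fun_prop

/-- Square integrability of a function on `Γ_h(t)`. -/
def SquareIntegrable (M : Mesh kg) (S : EvolvingSurface) (t : ℝ) (w : E3 → E3) : Prop :=
  ∀ τ, IntegrableOn (fun x => ‖w (M.elementMap S τ t x)‖ ^ 2 * areaElement (M.elementMap S τ t) x)
    refInterior

theorem massForm_self (t : ℝ) (w : E3 → E3) : M.massForm S t w w = ∑ τ, ∫ x in refInterior,
    ‖w (M.elementMap S τ t x)‖ ^ 2 * areaElement (M.elementMap S τ t) x := by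
  simp only [massForm, integral, real_inner_self_eq_norm_sq]

theorem massForm_self_nonneg (t : ℝ) (w : E3 → E3) : 0 ≤ M.massForm S t w w := by
  rw [massForm_self]
  exact Finset.sum_nonneg fun τ _ => setIntegral_nonneg measurableSet_refInterior fun x _ =>
    mul_nonneg (sq_nonneg _) (areaElement_nonneg _ _)

theorem strainForm_self_nonneg (t : ℝ) (w : E3 → E3) : 0 ≤ M.strainForm S t w w := by
  unfold strainForm integral frob
  exact Finset.sum_nonneg fun τ _ => setIntegral_nonneg measurableSet_refInterior fun x _ =>
    mul_nonneg (Finset.sum_nonneg fun i _ => Finset.sum_nonneg fun j _ => mul_self_nonneg _)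
      (areaElement_nonneg _ _)

theorem l2Norm_sq (t : ℝ) (w : E3 → E3) : M.l2Norm S t w ^ 2 = M.massForm S t w w :=
  Real.sq_sqrt (massForm_self_nonneg t w)

theorem energyNorm_sq_le (t : ℝ) (w : E3 → E3) :
    M.energyNorm S t w ^ 2 ≤ 2 * M.strainForm S t w w + 2 * M.massForm S t w w := by
  rw [energyNorm, ← l2Norm_sq, ← Real.sq_sqrt (strainForm_self_nonneg (M := M) (S := S) t w)]
  rw [Real.sqrt_sq (Real.sqrt_nonneg _)]
  nlinarith [sq_nonneg (Real.sqrt (M.strainForm S t w w) - M.l2Norm S t w)]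

/-- Equal arguments make each skew difference cancel identically, whatever the advecting field and
without any integrability. -/
theorem convForm_self (form : Convection) (t : ℝ) (z w : E3 → E3) :
    M.convForm S t form z w w = 0 := by
  cases form <;> simp [convForm]

theorem IsVectorFE.continuousOn {k : ℕ} {t : ℝ} {w : E3 → E3} (hw : M.IsVectorFE S k t w)
    (τ : Fin M.nT) : ContinuousOn (fun x => w (M.elementMap S τ t x)) refTriangle := by
  have h : ContinuousOn (fun x i => w (M.elementMap S τ t x) i) refTriangle :=
    continuousOn_pi.2 fun i => (hw i).1.comp (contDiff_elementMap τ t).continuous.continuousOn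
      fun x hx => Set.mem_iUnion.2 ⟨τ, x, hx, rfl⟩
  exact (PiLp.continuous_toLp 2 fun _ : Fin 3 => ℝ).comp_continuousOn h

theorem IsVectorFE.squareIntegrable {k : ℕ} {t : ℝ} {w : E3 → E3} (hw : M.IsVectorFE S k t w) :
    M.SquareIntegrable S t w := fun τ =>
  (((hw.continuousOn τ).norm.pow 2).mul
    (continuous_areaElement τ t).continuousOn).integrableOn_compact isCompact_refTriangle
    |>.mono_set refInterior_subset

theorem massForm_le {t : ℝ} {w v : E3 → E3} (hw : M.SquareIntegrable S t w)
    (hv : M.SquareIntegrable S t v) :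
    M.massForm S t w v ≤ 1 / 2 * M.massForm S t w w + 1 / 2 * M.massForm S t v v := by
  rw [massForm_self, massForm_self, Finset.mul_sum, Finset.mul_sum, ← Finset.sum_add_distrib]
  unfold massForm integral
  refine Finset.sum_le_sum fun τ _ => ?_
  rw [← integral_const_mul, ← integral_const_mul,
    ← integral_add ((hw τ).const_mul _) ((hv τ).const_mul _)]
  have ha := areaElement_nonneg (M.elementMap S τ t)
  refine setIntegral_refInterior_le (((hw τ).const_mul _).add ((hv τ).const_mul _))
    (fun x _ => by have := ha x; positivity) fun x _ => ?_
  rw [← mul_assoc, ← mul_assoc, ← add_mul]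
  refine mul_le_mul_of_nonneg_right ((real_inner_le_norm _ _).trans ?_) (ha x)
  nlinarith [sq_nonneg (‖w (M.elementMap S τ t x)‖ - ‖v (M.elementMap S τ t x)‖)]

theorem divForm_self_le {t C : ℝ} (hC0 : 0 ≤ C) {w : E3 → E3} (hw : M.SquareIntegrable S t w)
    (hC : ∀ τ, ∀ x ∈ refTriangle,
      |surfDiv (M.elementMap S τ t) (M.velocity S τ t) x| ≤ C) :
    M.divForm S t w w ≤ C * M.massForm S t w w := by
  rw [massForm_self, Finset.mul_sum]
  unfold divForm integral
  refine Finset.sum_le_sum fun τ _ => ?_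
  rw [← integral_const_mul]
  have ha := areaElement_nonneg (M.elementMap S τ t)
  refine setIntegral_refInterior_le ((hw τ).const_mul _)
    (fun x _ => by have := ha x; positivity) fun x hx => ?_
  beta_reduce
  rw [real_inner_self_eq_norm_sq, mul_assoc]
  exact mul_le_mul_of_nonneg_right ((le_abs_self _).trans (hC τ x (refInterior_subset hx)))
    (mul_nonneg (sq_nonneg _) (ha x))

/-- The time-lift preserves the pull-backs to the reference triangle. -/
theorem IsAdmissible.timeLift_elementMap (hM : M.IsAdmissible S) {s t : ℝ}
    (hs : s ∈ Set.Icc 0 S.T) (ht : t ∈ Set.Icc 0 S.T) (z : E3 → E3) (τ : Fin M.nT) {x : E2}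
    (hx : x ∈ refTriangle) :
    M.timeLift S s t z (M.elementMap S τ t x) = z (M.elementMap S τ s x) := by
  have h : ∃ a : Fin M.nT × E2, a.2 ∈ refTriangle ∧
      M.elementMap S a.1 t a.2 = M.elementMap S τ t x := ⟨(τ, x), hx, rfl⟩
  rw [timeLift, dif_pos h]
  obtain ⟨h1, h2⟩ := h.choose_spec
  -- The chosen preimage may be another one than (τ, x). Conformity at time t says that both have
  -- the same vertex weights, and conformity at time s that they then have the same image there.
  rw [hM.conforming t ht _ _ _ h1 _ hx, ← hM.conforming s hs _ _ _ h1 _ hx] at h2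
  rw [h2]

theorem IsAdmissible.squareIntegrable_timeLift (hM : M.IsAdmissible S) {s t : ℝ}
    (hs : s ∈ Set.Icc 0 S.T) (ht : t ∈ Set.Icc 0 S.T) {k : ℕ} {w : E3 → E3}
    (hw : M.IsVectorFE S k t w) : M.SquareIntegrable S s (M.timeLift S t s w) := fun τ => by
  refine IntegrableOn.congr_fun (f := fun x => ‖w (M.elementMap S τ t x)‖ ^ 2 *
    areaElement (M.elementMap S τ s) x) ?_ (fun x hx => ?_) measurableSet_refInterior
  · exact ((((hw.continuousOn τ).norm.pow 2).mul
      (continuous_areaElement τ s).continuousOn).integrableOn_compact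
        isCompact_refTriangle).mono_set refInterior_subset
  · simp only [hM.timeLift_elementMap ht hs w τ (refInterior_subset hx)]

/-- Both masses integrate the same pull-back; only the area elements differ. -/
theorem IsAdmissible.massForm_timeLift_le (hM : M.IsAdmissible S) {s t : ℝ}
    (hs : s ∈ Set.Icc 0 S.T) (ht : t ∈ Set.Icc 0 S.T) {k : ℕ} {w : E3 → E3}
    (hw : M.IsVectorFE S k t w) {E : ℝ} (hE : 0 ≤ E)
    (harea : ∀ τ, ∀ x ∈ refTriangle, areaElement (M.elementMap S τ s) x ≤
      E * areaElement (M.elementMap S τ t) x) :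
    M.massForm S s (M.timeLift S t s w) (M.timeLift S t s w) ≤ E * M.massForm S t w w := by
  rw [massForm_self, massForm_self, Finset.mul_sum]
  refine Finset.sum_le_sum fun τ _ => ?_
  rw [← integral_const_mul]
  refine setIntegral_refInterior_le ((hw.squareIntegrable τ).const_mul _) (fun x _ => by
    have := areaElement_nonneg (M.elementMap S τ t) x
    positivity) fun x hx => ?_
  have hx' := refInterior_subset hx
  rw [hM.timeLift_elementMap ht hs w τ hx', mul_left_comm]
  exact mul_le_mul_of_nonneg_left (harea τ x hx') (sq_nonneg _)

end Mesh

/-- An implicit discrete Gronwall inequality. -/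
theorem implicit_discrete_gronwall {U e F : ℕ → ℝ} {D dt : ℝ} (hD : 0 ≤ D) (hdt : 0 ≤ dt)
    (hDdt : D * dt ≤ 1 / 2) (he : ∀ k, 0 ≤ e k) (hF : ∀ k, 0 ≤ F k)
    (hU : ∀ k, 0 ≤ U k) {n : ℕ}
    (hstep : ∀ k < n, U (k + 1) + dt * e (k + 1) ≤
      U k + dt * F (k + 1) + D * dt * U (k + 1)) :
    U n + dt * ∑ k ∈ Finset.Icc 1 n, e k ≤
      Real.exp (2 * D * (n * dt)) * (U 0 + dt * ∑ k ∈ Finset.range (n + 1), F k) := by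
  induction n with
  | zero => simpa using mul_nonneg hdt (hF 0)
  | succ n ih =>
    have ih := ih fun k hk => hstep k (by omega)
    have hs := hstep n (by omega)
    rw [Finset.sum_Icc_succ_top (by omega), Finset.sum_range_succ _ (n + 1)]
    set A := ∑ k ∈ Finset.Icc 1 n, e k
    have hA : 0 ≤ A := Finset.sum_nonneg fun k _ => he k
    set R := U 0 + dt * ∑ k ∈ Finset.range (n + 1), F k with hR
    set x := D * dt with hx
    have hx0 : 0 ≤ x := mul_nonneg hD hdt
    set y := U (n + 1) + dt * (A + e (n + 1)) with hy
    have hAe : 0 ≤ dt * (A + e (n + 1)) := mul_nonneg hdt (add_nonneg hA (he _))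
    have hy0 : 0 ≤ y := add_nonneg (hU _) hAe
    have hE1 : 1 ≤ Real.exp (2 * D * (n * dt)) := Real.one_le_exp (by positivity)
    -- The implicit term x · U (n + 1) is at most x · y, so it can be absorbed on the left.
    have h1 : (1 - x) * y ≤ Real.exp (2 * D * (n * dt)) * (R + dt * F (n + 1)) := by
      have h2 : x * U (n + 1) ≤ x * y := mul_le_mul_of_nonneg_left (by linarith) hx0
      have h3 : dt * F (n + 1) ≤ Real.exp (2 * D * (n * dt)) * (dt * F (n + 1)) :=
        le_mul_of_one_le_left (mul_nonneg hdt (hF _)) hE1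
      linarith
    -- Here x ≤ 1/2 enters: (1 + 2x)(1 - x) = 1 + x(1 - 2x) ≥ 1.
    have h2 : 1 ≤ Real.exp (2 * x) * (1 - x) := by
      have h3 : 2 * x + 1 ≤ Real.exp (2 * x) := Real.add_one_le_exp _
      nlinarith
    calc y ≤ Real.exp (2 * x) * (1 - x) * y := le_mul_of_one_le_left hy0 h2
      _ = Real.exp (2 * x) * ((1 - x) * y) := by ring
      _ ≤ Real.exp (2 * x) * (Real.exp (2 * D * (n * dt)) * (R + dt * F (n + 1))) := by gcongr
      _ = _ := by
        rw [← mul_assoc, ← Real.exp_add, hR, mul_add dt, add_assoc, hx]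
        congr 2
        push_cast
        ring

theorem Real.exp_le_one_add_two_mul {x : ℝ} (hx : 0 ≤ x) (hx' : x ≤ 1 / 2) :
    Real.exp x ≤ 1 + 2 * x := by
  refine (Real.exp_bound_div_one_sub_of_interval hx (by linarith)).trans ?_
  rw [div_le_iff₀ (by linarith)]
  nlinarith

/-- The energy inequality for one time step. -/
theorem Mesh.IsDiscreteSolution.energy_step {kg : ℕ} {M : Mesh kg} {S : EvolvingSurface}
    (hM : M.IsAdmissible S) {C : ℝ} (hC : 0 < C)
    (hbound : ∀ τ, ∀ x ∈ refTriangle, ∀ t ∈ Set.Icc 0 S.T,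
      |surfDiv (M.elementMap S τ t) (M.velocity S τ t) x| ≤ C ∧
        ∀ s ∈ Set.Icc 0 S.T, s ≤ t → areaElement (M.elementMap S τ s) x ≤
          Real.exp (C * (t - s)) * areaElement (M.elementMap S τ t) x)
    {ku kl n : ℕ} {form : Convection} {dt : ℝ} (hdt : 0 < dt) (hCdt : C * dt ≤ 1 / 2)
    (hT : n * dt ≤ S.T) {f u : ℕ → E3 → E3} {p lam : ℕ → E3 → ℝ}
    (hf : ∀ k ≤ n, M.MemL2 S (k * dt) (f k))
    (hsol : M.IsDiscreteSolution S ku kl form n dt f u p lam) {k : ℕ} (hk : k < n) :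
    M.massForm S ((k + 1 : ℕ) * dt) (u (k + 1)) (u (k + 1)) +
        dt * M.energyNorm S ((k + 1 : ℕ) * dt) (u (k + 1)) ^ 2 ≤
      M.massForm S (k * dt) (u k) (u k) +
        dt * M.massForm S ((k + 1 : ℕ) * dt) (f (k + 1)) (f (k + 1)) +
        (4 * C + 3) * dt * M.massForm S ((k + 1 : ℕ) * dt) (u (k + 1)) (u (k + 1)) := by
  have htime : ∀ j ≤ n, (j : ℝ) * dt ∈ Set.Icc 0 S.T := fun j hj =>
    ⟨by positivity, le_trans (by gcongr) hT⟩
  have hmem : k + 1 ∈ Finset.Icc 1 n := Finset.mem_Icc.2 ⟨by omega, by omega⟩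
  have hu : M.IsVectorFE S ku ((k + 1 : ℕ) * dt) (u (k + 1)) := hsol.velocity_mem _ hmem
  have hu' : M.IsVectorFE S ku (k * dt) (u k) := by
    rcases Nat.eq_zero_or_pos k with rfl | h
    · simpa using hsol.initial.1
    · exact hsol.velocity_mem k (Finset.mem_Icc.2 ⟨h, hk.le⟩)
  have hmom := hsol.momentum _ hmem _ hu
  rw [Mesh.convForm_self, hsol.constraint _ hmem _ _ (hsol.pressure_mem _ hmem)
    (hsol.multiplier_mem _ hmem), add_zero, add_zero, Nat.add_sub_cancel] at hmom
  have hs := htime k hk.le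
  have ht := htime (k + 1) hk
  set s : ℝ := k * dt
  set t : ℝ := (k + 1 : ℕ) * dt with ht_def
  have hts : t - s = dt := by simp only [t, s]; push_cast; ring
  have h1 := Mesh.massForm_le hu'.squareIntegrable (hM.squareIntegrable_timeLift hs ht hu)
  have h2 := hM.massForm_timeLift_le hs ht hu (Real.exp_pos (C * (t - s))).le fun τ x hx =>
    (hbound τ x hx t ht).2 s hs (by linarith)
  have h3 := Mesh.divForm_self_le hC.le hu.squareIntegrable fun τ x hx => (hbound τ x hx t ht).1
  have h4 := Mesh.massForm_le (fun τ => (hf (k + 1) hk τ).2) hu.squareIntegrable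
  have h5 := Mesh.energyNorm_sq_le (M := M) (S := S) t (u (k + 1))
  have hU := Mesh.massForm_self_nonneg (M := M) (S := S) t (u (k + 1))
  rw [hts] at h2
  have h6 := mul_le_mul_of_nonneg_right
    (Real.exp_le_one_add_two_mul (mul_nonneg hC.le hdt.le) hCdt) hU
  have h7 := mul_le_mul_of_nonneg_left h5 hdt.le
  have h8 := mul_le_mul_of_nonneg_left h3 hdt.le
  have h9 := mul_le_mul_of_nonneg_left h4 hdt.le
  have h10 := congrArg (dt * ·) hmom
  simp only [mul_add, mul_sub, ← mul_assoc, mul_one_div_cancel hdt.ne', one_mul] at h10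
  -- After doubling the balance, 4C collects 2C from the area change and 2C from the divergence
  -- term; 3 collects 1 from Young's inequality on the force and 2 from the mass inside the squared
  -- energy norm.
  nlinarith

theorem mainTheorem5 (S : EvolvingSurface) (kg ku kl : ℕ) (hkg : 1 ≤ kg) (hku : 2 ≤ ku)
    (hkl : 1 ≤ kl) (ρ : ℝ) (hρ : 0 < ρ) :
    ∃ c > 0, ∃ h₀ > 0, ∃ dt₀ > 0,
      ∀ M : Mesh kg, M.IsAdmissible S → M.IsUniformlyQuasiUniform S ρ → M.meshSize S ≤ h₀ →
      ∀ N : ℕ, 0 < N → ∀ dt : ℝ, dt = S.T / N → dt ≤ dt₀ →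
      ∀ (form : Convection) (f u : ℕ → E3 → E3) (p lam : ℕ → E3 → ℝ),
      ∀ n : ℕ, 1 ≤ n → n ≤ N → (∀ k ≤ n, M.MemL2 S (k * dt) (f k)) →
        M.IsDiscreteSolution S ku kl form n dt f u p lam →
          M.l2Norm S (n * dt) (u n) ^ 2 +
              dt * ∑ k ∈ Finset.Icc 1 n, M.energyNorm S (k * dt) (u k) ^ 2 ≤
            Real.exp (c * (n * dt)) * (M.l2Norm S 0 (u 0) ^ 2 +
              dt * ∑ k ∈ Finset.range (n + 1), M.l2Norm S (k * dt) (f k) ^ 2) := by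
  obtain ⟨C, hC, h₀, hh₀, H⟩ := Mesh.exists_surfDiv_areaElement_bound S hkg hρ
  -- With D = 4C + 3 from the energy step, Gronwall yields the rate 2D and requires D · dt ≤ 1/2.
  refine ⟨2 * (4 * C + 3), by positivity, h₀, hh₀, 1 / (2 * (4 * C + 3)), by positivity, ?_⟩
  intro M hM hQ hmesh N hN dt hdt hdt₀ form f u p lam n _ hnN hf hsol
  have hN' : (0 : ℝ) < N := Nat.cast_pos.2 hN
  have hdt0 : 0 < dt := hdt ▸ div_pos S.T_pos hN'
  have hDdt : (4 * C + 3) * dt ≤ 1 / 2 := by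
    rw [le_div_iff₀ (by positivity)] at hdt₀
    linarith
  have hCdt : C * dt ≤ 1 / 2 := by nlinarith
  have hT : n * dt ≤ S.T := by
    calc (n : ℝ) * dt ≤ N * dt := by gcongr
      _ = S.T := by rw [hdt]; field_simp
  have h := implicit_discrete_gronwall (U := fun k => M.massForm S (k * dt) (u k) (u k))
    (e := fun k => M.energyNorm S (k * dt) (u k) ^ 2)
    (F := fun k => M.massForm S (k * dt) (f k) (f k)) (D := 4 * C + 3) (n := n) (by positivity)
    hdt0.le hDdt (fun k => sq_nonneg _) (fun k => Mesh.massForm_self_nonneg _ _)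
    (fun k => Mesh.massForm_self_nonneg _ _)
    fun k hk => hsol.energy_step hM hC (H M hM hQ hmesh) hdt0 hCdt hT hf hk
  simpa only [Mesh.l2Norm_sq, Nat.cast_zero, zero_mul] using h
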